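/- Fix constants $0<\rho<1/4$ and $0<\beta\le\rho/8$, and let $\varepsilon=\varepsilon(n)>0$ satisfy $\varepsilon^{-1}=o(\log^{1/4} n)$. For a simple graph $G$ on $n$ vertices let $\bar d=\frac1n\sum_v\deg(v)$. Write $\mathrm{Lap}(b)$ for the distribution on $\mathbb R$ with density $\frac1{2b}e^{-|z|/b}$, and put $t=\lceil\log_{1+\beta}n\rceil$, $s=t\cdot\frac{\log^2 n}{\rho^2}\sqrt{\frac n\rho}\,\bigl(1+\frac1\varepsilon\bigr)$ rounded up to an integer (and replaced by $n$ if it exceeds $n$), $T=\frac12\sqrt{\frac\rho n}\cdot\frac{\varepsilon}{1+\varepsilon}\cdot\frac1t$, $M=\frac13\sqrt{\frac{\rho}{n\sqrt{\log n}}}\cdot\frac st$, $L=\log_{1+\beta}\frac{6M}{\beta}+2$, $L'=\log_{1+\beta}\bigl\lceil\frac{6M}{\beta}\bigr\rceil+2$ and $D=6M\bigl(3+\beta+\frac1\beta\bigr)$. All random choices below are independent. Main algorithm on input $G$: 1. Choose a uniformly random set $S$ of $s$ vertices (sampling without replacement), and for every vertex $v$ let $\tilde d(v)=\deg(v)+Y_v$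 with $Y_v\sim\mathrm{Lap}(6/\varepsilon)$. For each integer $i$ let bucket $i$ be $\{v:\tilde d(v)\in((1+\beta)^{i-1},(1+\beta)^i]\}$ and let $\tilde S_i$ be its intersection with $S$. The merged bucket is $\{v:\tilde d(v)\le(1+\beta)^{\lfloor L\rfloor}\}$ and $S_1$ is its intersection with $S$. Let $I=\{i>L:\ |\tilde S_i|\ge 1.2\,T\,|S|\}$. Call $S_1$ small if $|S_1|<1.2\,T\sqrt{|S|}\,|S|$. 2. For every $i\in I$ and $v\in\tilde S_i$ pick a uniformly random neighbor $r(v)$ of $v$. If $S_1$ is small, set $X(v)=1$ if $r(v)$ lies in the merged bucket or in a bucket $j\notin I$, and $X(v)=0$ otherwise. If $S_1$ is not small, set $X(v)=1$ if $r(v)$ lies in a bucket $j\notin I$ with $j>L'$, and $X(v)=0$ otherwise. Let $\tilde\alpha_i=\bigl(Z_i+\sum_{v\in\tilde S_i}X(v)\bigr)/|\tilde S_i|$ with $Z_i\sim\mathrm{Lap}(6/\varepsilon)$. 3. If $S_1$ is small, output $\tilde d=\frac1{|S|}\sum_{i\in I}|\tilde S_i|(1+\tilde\alpha_i)(1+\beta)^i$.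 Otherwise, for every $v\in S_1$ pick a uniformly random neighbor $r(v)$, let $X(v)=1$ if $r(v)$ lies in a bucket $j\notin I$ with $j>L'$ and $X(v)=0$ otherwise, and output $$\tilde d=\frac1{|S|}\Bigl(\sum_{i\in I}|\tilde S_i|(1+\tilde\alpha_i)(1+\beta)^i+Z+\sum_{v\in S_1}(1+X(v))\min\{\deg(v),D\}\Bigr),\qquad Z\sim\mathrm{Lap}(6D).$$ (If $v$ has no neighbor, $X(v)=0$.) Theorem. There is a function $\delta(n)\to0$, depending only on $\rho$, $\beta$ and the function $\varepsilon$, such that for all sufficiently large $n$ and every simple graph $G$ on $n$ vertices with $\bar d\ge1$, the output $\tilde d$ of the main algorithm satisfies, with probability at least $1-\delta(n)$, $$(1-\rho)\,\bar d\le\tilde d\le(1+\rho)\,\bar d.$$ -/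

import Mathlib

open MeasureTheory Filter Topology

noncomputable section

namespace DPAvgDegree

/-! ### Graphs -/

/-- The degree of a vertex, as a real number. -/
def deg {n : ℕ} (G : SimpleGraph (Fin n)) (v : Fin n) : ℝ :=
  ((G.neighborSet v).ncard : ℝ)

/-- The average degree of a graph on `n` vertices. -/
def avgDegree {n : ℕ} (G : SimpleGraph (Fin n)) : ℝ :=
  (∑ v, deg G v) / n

/-! ### Random sources -/

/-- The Laplace distribution `Lap(b)`, with density `z ↦ exp (-|z| / b) / (2 b)`. -/
def laplace (b : ℝ) : Measure ℝ :=
  volume.withDensity fun z => ENNReal.ofReal (1 / (2 * b) * Real.exp (-|z| / b))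

theorem isProbabilityMeasure_laplace {b : ℝ} (hb : 0 < b) :
    IsProbabilityMeasure (laplace b) := by
  have hI : ∫ z : ℝ, 1 / (2 * b) * Real.exp (-|z| / b) = 1 := by
    have h := integral_comp_abs (f := fun x : ℝ => 1 / (2 * b) * Real.exp (-x / b))
    rw [h, integral_const_mul]
    have h2 : ∫ x in Set.Ioi (0 : ℝ), Real.exp (-x / b) = b := by
      have h3 := integral_comp_mul_left_Ioi (fun x : ℝ => Real.exp (-x)) 0 (inv_pos.mpr hb)
      rw [mul_zero, integral_exp_neg_Ioi_zero, inv_inv, smul_eq_mul, mul_one] at h3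
      refine Eq.trans ?_ h3
      congr 1
      ext x
      congr 1
      field_simp
    rw [h2]
    field_simp
  have hint : Integrable fun z : ℝ => 1 / (2 * b) * Real.exp (-|z| / b) := by
    by_contra hn
    rw [integral_undef hn] at hI
    exact zero_ne_one hI
  refine ⟨?_⟩
  rw [laplace, withDensity_apply _ MeasurableSet.univ, Measure.restrict_univ,
    ← ofReal_integral_eq_lintegral_ofReal hint
      (Filter.Eventually.of_forall fun z => by positivity), hI, ENNReal.ofReal_one]

/-- Answers to neighbor queries: `some w`, or `none` for the answer `⊥`. All sets of answers
are events. -/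
instance instMeasurableSpaceAnswer (n : ℕ) : MeasurableSpace (Option (Fin n)) := ⊤

open scoped Classical in
/-- A uniformly random neighbor of `v`; the answer is `⊥` if `v` is isolated. -/
def randomNeighbor {n : ℕ} (G : SimpleGraph (Fin n)) (v : Fin n) : PMF (Option (Fin n)) :=
  if h : (G.neighborFinset v).Nonempty then (PMF.uniformOfFinset (G.neighborFinset v) h).map some
  else PMF.pure none

/-- A uniformly random set of `s` vertices out of `n` (sampling without replacement). -/
def randomSample {n s : ℕ} (h : s ≤ n) : PMF (Finset (Fin n)) :=
  PMF.uniformOfFinset (Finset.powersetCard s (Finset.univ : Finset (Fin n)))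
    (Finset.powersetCard_nonempty.mpr (by simpa using h))

/-! ### Parameters -/

/-- Accuracy parameter `ρ`, bucket width `β`, privacy parameter `ε`. -/
structure Params where
  ρ : ℝ
  β : ℝ
  ε : ℝ

namespace Params

variable (P : Params) (n : ℕ)

/-- `t = ⌈log_{1+β} n⌉`. -/
def t : ℕ := ⌈Real.logb (1 + P.β) n⌉₊

/-- The number `|S|` of sampled vertices, `t (log² n / ρ²) √(n / ρ) (1 + 1 / ε)` rounded up
(all vertices are sampled if this exceeds `n`, which happens for small `n` only). -/
def sampleSize : ℕ :=
  min n ⌈P.t n * (Real.log n ^ 2 / P.ρ ^ 2) * √(n / P.ρ) * (1 + 1 / P.ε)⌉₊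

theorem sampleSize_le : P.sampleSize n ≤ n := min_le_left _ _

/-- The size threshold `T`. -/
def T : ℝ := 1 / 2 * √(P.ρ / n) * (P.ε / (1 + P.ε)) * (1 / P.t n)

/-- The quantity `M_{ρ,n}`. -/
def M : ℝ := 1 / 3 * √(P.ρ / (n * √(Real.log n))) * (P.sampleSize n / P.t n)

/-- `log_{1+β} (6 M / β) + 2`: buckets with at most this index are merged. -/
def cutoff : ℝ := Real.logb (1 + P.β) (6 * P.M n / P.β) + 2

/-- `log_{1+β} ⌈6 M / β⌉ + 2`: the variant of `cutoff` used when testing random neighbors. -/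
def ceilCutoff : ℝ := Real.logb (1 + P.β) ((⌈6 * P.M n / P.β⌉ : ℤ) : ℝ) + 2

/-- The bound `6 M (3 + β + 1 / β)` at which degrees in the merged bucket are clamped. -/
def clamp : ℝ := 6 * P.M n * (3 + P.β + 1 / P.β)

/-- A noisy degree `x` falls into the bucket with index `i`. -/
def InBucket (i : ℤ) (x : ℝ) : Prop := (1 + P.β) ^ (i - 1) < x ∧ x ≤ (1 + P.β) ^ i

/-- A noisy degree `x` falls into the merged bucket: it is at most the right end of the last
bucket whose index does not exceed `cutoff`. Nonpositive noisy degrees are included. -/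
def InMerged (x : ℝ) : Prop := x ≤ (1 + P.β) ^ ⌊P.cutoff n⌋

end Params

/-! ### The algorithm, as a function of the graph and of its random coins -/

section Algorithm

variable (P : Params) {n : ℕ} (G : SimpleGraph (Fin n))

/-- `NoisyDegree`: the noisy degrees of all vertices, for the noise `Y`. -/
def noisyDegree (Y : Fin n → ℝ) (v : Fin n) : ℝ := deg G v + Y v

/-! In what follows `d` stands for the noisy degrees and `S` for the sample. -/

variable (d : Fin n → ℝ) (S : Finset (Fin n))

open scoped Classical in
/-- The sampled vertices in bucket `i`. -/
def sampleBucket (i : ℤ) : Finset (Fin n) := S.filter fun v => P.InBucket i (d v)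

open scoped Classical in
/-- The sampled vertices in the merged bucket, `S₁`. -/
def mergedSample : Finset (Fin n) := S.filter fun v => P.InMerged n (d v)

/-- The set `I` of indices of big buckets. -/
def bigIndices : Set ℤ :=
  {i | P.cutoff n < i ∧ 1.2 * P.T n * S.card ≤ (sampleBucket P d S i).card}

/-- `S₁` is a small bucket. -/
def MergedSmall : Prop :=
  ((mergedSample P d S).card : ℝ) < 1.2 * P.T n * √(S.card : ℝ) * S.card

/-- `w` lies in a small bucket, when the merged bucket itself counts as small. -/
def InSmall (w : Fin n) : Prop :=
  P.InMerged n (d w) ∨ ∃ i : ℤ, i ∉ bigIndices P d S ∧ P.InBucket i (d w)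

/-- `w` lies in a small bucket other than the merged one. -/
def InSmallUnmerged (w : Fin n) : Prop :=
  ∃ i : ℤ, i ∉ bigIndices P d S ∧ P.ceilCutoff n < i ∧ P.InBucket i (d w)

open scoped Classical in
/-- The indicator `X(v)` in `NoisyBigSmallEdgeCount`, as a function of the random neighbor
`a` of `v`. -/
def edgeIndicator (a : Option (Fin n)) : ℝ :=
  if ∃ w, a = some w ∧
    ((MergedSmall P d S ∧ InSmall P d S w) ∨ (¬ MergedSmall P d S ∧ InSmallUnmerged P d S w))
  then 1 else 0

open scoped Classical in
/-- The indicator `X(v)` in `NoisyAvgDegree`, as a function of the random neighbor `a` of `v`. -/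
def mergedEdgeIndicator (a : Option (Fin n)) : ℝ :=
  if ∃ w, a = some w ∧ InSmallUnmerged P d S w then 1 else 0

/-- `NoisyBigSmallEdgeCount`: the estimates `α̃ᵢ = Wᵢ / |S̃ᵢ|`, for the random neighbors `r` and
the noise `Zb`. -/
def alphaEstimate (r : Fin n → Option (Fin n)) (Zb : ℤ → ℝ) (i : ℤ) : ℝ :=
  (∑ v ∈ sampleBucket P d S i, edgeIndicator P d S (r v) + Zb i) / (sampleBucket P d S i).card

/-- The clamped degree `deg'`. -/
def clampedDeg (v : Fin n) : ℝ := min (deg G v) (P.clamp n)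

/-- The contribution of the big buckets, `∑_{i ∈ I} |S̃ᵢ| (1 + α̃ᵢ) (1 + β)ⁱ`. -/
def bigSum (α : ℤ → ℝ) : ℝ :=
  ∑ᶠ i ∈ bigIndices P d S, ((sampleBucket P d S i).card : ℝ) * (1 + α i) * (1 + P.β) ^ i

open scoped Classical in
/-- `NoisyAvgDegree`, for the estimates `α`, the random neighbors `r` and the noise `Z`. -/
def noisyAvgDegree (α : ℤ → ℝ) (r : Fin n → Option (Fin n)) (Z : ℝ) : ℝ :=
  if MergedSmall P d S then 1 / (S.card : ℝ) * bigSum P d S α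
  else 1 / (S.card : ℝ) * (bigSum P d S α + Z +
    ∑ v ∈ mergedSample P d S, (1 + mergedEdgeIndicator P d S (r v)) * clampedDeg P G v)

/-- The coins: the sample `S` and the noise `Y` of `NoisyDegree`; the random neighbors and the
noise `Zb` of `NoisyBigSmallEdgeCount`; the random neighbors and the noise `Z` of
`NoisyAvgDegree`. -/
abbrev Coins (n : ℕ) : Type :=
  (Finset (Fin n) × (Fin n → ℝ)) × ((Fin n → Option (Fin n)) × (ℤ → ℝ)) ×
    ((Fin n → Option (Fin n)) × ℝ)

/-- The law of the coins; all of them are independent. -/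
def coinLaw : Measure (Coins n) :=
  ((randomSample (P.sampleSize_le n)).toMeasure.prod (Measure.pi fun _ => laplace (6 / P.ε))).prod
    (((Measure.pi fun v => (randomNeighbor G v).toMeasure).prod
        (Measure.infinitePi fun _ : ℤ => laplace (6 / P.ε))).prod
      ((Measure.pi fun v => (randomNeighbor G v).toMeasure).prod
        (laplace (36 * P.M n * (3 + P.β + 1 / P.β)))))

/-- The output `d̃` of the main algorithm on the graph `G` with coins `c`. -/
def mainAlgorithm (c : Coins n) : ℝ :=
  let S := c.1.1
  let d := noisyDegree G c.1.2
  let α := alphaEstimate P d S c.2.1.1 c.2.1.2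
  noisyAvgDegree P G d S α c.2.2.1 c.2.2.2

end Algorithm

end DPAvgDegree

end

open MeasureTheory Filter Topology

noncomputable section

namespace DPAvgDegree

/-! ### Tail bounds for the Laplace distribution -/

/-! The degree sum is nearly determined by a set U of vertices that the sample represents well. An
edge inside U is counted twice by the degrees in U; an edge from U to a disjoint set C is counted
once there and once more by `degIn G C`. So F = ∑_{v ∈ U} (deg v + degIn C v) never exceeds the
degree sum, and it loses at most the edges inside a set C' ⊆ C of vertices in small buckets and the
edges at a set Q of small total degree (`sum_deg_add_degIn_le`, `sum_deg_le_sum_deg_add_degIn`). At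
most t buckets are small and each has O(Tn) vertices, so |C'| ≤ 0.612 √(ρn) (`card_small_le`). With
γ = ρ/100 the loss is below 0.375 ρn + γn, a relative error below ρ because the average degree is at
least 1 (`output_bounds`).

The algorithm's sum must then approximate (s/n) F. Beyond the merged bucket noisy degrees exceed 6M
while the noise is at most γM, so the degrees in a bucket agree up to factors close to one
(`zpow_label_bounds`), and only the bucket size and the fractions of neighbors in C need estimating
(`bucket_term_bounds`). In the merged bucket degrees are polylogarithmic, clamping changes nothing,
and the sum concentrates (`merged_bounds`).

The set C depends on which buckets are big, hence on the sample. The degree noise is therefore fixed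
first, which fixes all labels, and concentration is required for all 2^t possible sets of big labels
(`not_sampleGood_le`). Since t = O(log n), this union bound is polynomial in n and is beaten by
exp(-γ² log² n). Given sample and labels, the neighbor queries are independent and Hoeffding's
inequality applies. Outside `Good` the probability is at most 20/n (`not_good_le`,
`Large.failure_le`); on `Good` the bound is deterministic (`mainAlgorithm_bounds`). -/

theorem laplace_tail {b x : ℝ} (hb : 0 < b) :
    laplace b {z | x ≤ |z|} ≤ ENNReal.ofReal (2 * Real.exp (-x / (2 * b))) := by
  have hm : MeasurableSet {z : ℝ | x ≤ |z|} := measurableSet_le measurable_const (by fun_prop)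
  have h2b : IsProbabilityMeasure (laplace (2 * b)) := isProbabilityMeasure_laplace (by positivity)
  calc laplace b {z | x ≤ |z|}
      = ∫⁻ z in {z | x ≤ |z|}, ENNReal.ofReal (1 / (2 * b) * Real.exp (-|z| / b)) := by
        rw [laplace, withDensity_apply _ hm]
    -- On the tail, half of the exponent is bounded by its value at x; the other half is, up to a
    -- factor 2, the density of Lap(2b), of total mass one.
    _ ≤ ∫⁻ z in {z | x ≤ |z|}, ENNReal.ofReal (2 * Real.exp (-x / (2 * b))) *
          ENNReal.ofReal (1 / (2 * (2 * b)) * Real.exp (-|z| / (2 * b))) := by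
        refine setLIntegral_mono' hm fun z hz => ?_
        rw [← ENNReal.ofReal_mul (by positivity)]
        refine ENNReal.ofReal_le_ofReal ?_
        have h1 : Real.exp (-|z| / b) ≤ Real.exp (-x / (2 * b)) * Real.exp (-|z| / (2 * b)) := by
          rw [← Real.exp_add]
          refine Real.exp_le_exp.mpr ?_
          have hz' : x ≤ |z| := hz
          rw [← add_div, div_le_div_iff₀ hb (by positivity)]
          nlinarith
        calc 1 / (2 * b) * Real.exp (-|z| / b)
            ≤ 1 / (2 * b) * (Real.exp (-x / (2 * b)) * Real.exp (-|z| / (2 * b))) := by gcongr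
          _ = _ := by field_simp
    _ = ENNReal.ofReal (2 * Real.exp (-x / (2 * b))) * laplace (2 * b) {z | x ≤ |z|} := by
        rw [lintegral_const_mul' _ _ ENNReal.ofReal_ne_top, laplace, withDensity_apply _ hm]
    _ ≤ ENNReal.ofReal (2 * Real.exp (-x / (2 * b))) * 1 := by
        gcongr
        exact prob_le_one
    _ = _ := mul_one _

/-! ### Sampling without replacement -/

/-- Up to normalization this is the probability that a uniform s-set contains a given a-set; each
further element costs a factor (s - a)/(n - a) ≤ s/n. -/
theorem choose_sub_sub_le {n s : ℕ} (hs : s ≤ n) (a : ℕ) (ha : a ≤ s) :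
    ((n - a).choose (s - a) : ℝ) ≤ n.choose s * ((s : ℝ) / n) ^ a := by
  induction a with
  | zero => simp
  | succ a ih =>
    have ih := ih (by omega)
    have hn : (0 : ℝ) < n := by exact_mod_cast (by omega : 0 < n)
    obtain ⟨m, hm⟩ : ∃ m, n - a = m + 1 := ⟨n - a - 1, by omega⟩
    obtain ⟨k, hk⟩ : ∃ k, s - a = k + 1 := ⟨s - a - 1, by omega⟩
    have h1 : n - (a + 1) = m := by omega
    have h2 : s - (a + 1) = k := by omega
    rw [h1, h2]
    rw [hm, hk] at ih
    have h3 : ((m + 1 : ℕ) : ℝ) * m.choose k = (m + 1).choose (k + 1) * (k + 1 : ℕ) := by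
      exact_mod_cast Nat.add_one_mul_choose_eq m k
    have h4 : ((k + 1 : ℕ) : ℝ) * n ≤ s * (m + 1 : ℕ) := by
      have : (k + 1) * n ≤ s * (m + 1) := by
        rw [← hk, ← hm]
        zify [show a ≤ s by omega, show a ≤ n by omega]
        have : (a : ℤ) * s ≤ a * n := by
          gcongr
        nlinarith
      exact_mod_cast this
    have hm0 : (0 : ℝ) < (m + 1 : ℕ) := by positivity
    have h5 : (m.choose k : ℝ) ≤ (m + 1).choose (k + 1) * (s / n) := by
      rw [mul_div_assoc', le_div_iff₀ hn]
      refine le_of_mul_le_mul_left ?_ hm0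
      calc ((m + 1 : ℕ) : ℝ) * (m.choose k * n) = (m + 1).choose (k + 1) * ((k + 1 : ℕ) * n) := by
            rw [← mul_assoc, h3]; ring
        _ ≤ (m + 1).choose (k + 1) * (s * (m + 1 : ℕ)) := by gcongr
        _ = _ := by ring
    calc (m.choose k : ℝ) ≤ (m + 1).choose (k + 1) * (s / n) := h5
      _ ≤ (n.choose s * ((s : ℝ) / n) ^ a) * (s / n) := by gcongr
      _ = _ := by ring

/-- Expanding the product over subsets A of S reduces this to counting the samples that contain A.
Sampling without replacement is thus dominated by independent inclusion with probability s/n;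
nonnegativity of x makes the termwise comparison legitimate. -/
theorem sum_powersetCard_prod_le {n s : ℕ} (hs : s ≤ n) (x : Fin n → ℝ) (hx : ∀ v, 0 ≤ x v) :
    ∑ S ∈ Finset.powersetCard s (Finset.univ : Finset (Fin n)), ∏ v ∈ S, (1 + x v) ≤
      n.choose s * ∏ v, (1 + (s : ℝ) / n * x v) := by
  classical
  have h1 : ∀ S : Finset (Fin n), ∏ v ∈ S, (1 + x v) =
      ∑ A : Finset (Fin n), if A ⊆ S then ∏ v ∈ A, x v else 0 := by
    intro S
    rw [Finset.prod_one_add, ← Finset.sum_filter]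
    refine Finset.sum_congr ?_ fun _ _ => rfl
    ext A
    simp
  have h2 : ∀ A : Finset (Fin n),
      ((((Finset.powersetCard s Finset.univ).filter (A ⊆ ·)).card : ℕ) : ℝ) ≤
        n.choose s * ((s : ℝ) / n) ^ A.card := by
    intro A
    by_cases hA : A.card ≤ s
    · have h := Finset.card_filter_powersetCard_subset A Finset.univ s (Finset.subset_univ _) hA
      rw [Finset.card_univ, Fintype.card_fin] at h
      rw [h]
      exact choose_sub_sub_le hs _ hA
    · rw [Finset.filter_false_of_mem]
      · simp
        positivity
      · intro S hS hAS
        have := Finset.card_le_card hAS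
        rw [(Finset.mem_powersetCard.mp hS).2] at this
        omega
  simp_rw [h1]
  rw [Finset.sum_comm, Finset.prod_one_add, Finset.mul_sum, Finset.powerset_univ]
  refine Finset.sum_le_sum fun A _ => ?_
  rw [← Finset.sum_filter, Finset.sum_const, nsmul_eq_mul, Finset.prod_mul_distrib,
    Finset.prod_const, ← mul_assoc]
  exact mul_le_mul_of_nonneg_right (h2 A) (Finset.prod_nonneg fun v _ => hx v)

theorem sum_powersetCard_exp_le {n s : ℕ} (hs : s ≤ n) (f : Fin n → ℝ) (hf : ∀ v, 0 ≤ f v) :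
    ∑ S ∈ Finset.powersetCard s (Finset.univ : Finset (Fin n)), Real.exp (∑ v ∈ S, f v) ≤
      n.choose s * Real.exp ((s : ℝ) / n * ∑ v, (Real.exp (f v) - 1)) := by
  have h := sum_powersetCard_prod_le hs (fun v => Real.exp (f v) - 1)
    (fun v => by linarith [Real.one_le_exp (hf v)])
  simp only [add_sub_cancel] at h
  simp_rw [Real.exp_sum, Finset.mul_sum]
  refine h.trans ?_
  rw [Real.exp_sum]
  gcongr with v
  · intro v _
    have : 0 ≤ Real.exp (f v) - 1 := by linarith [Real.one_le_exp (hf v)]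
    positivity
  · rw [add_comm]; exact Real.add_one_le_exp _

/-- Negative exponents would give negative weights in `sum_powersetCard_prod_le`. Passing to the
complement, a uniform (n - s)-set, makes them nonnegative at the price of the constant factor exp(-∑
f). -/
theorem sum_powersetCard_exp_neg_le {n s : ℕ} (hs : s ≤ n) (f : Fin n → ℝ) (hf : ∀ v, 0 ≤ f v) :
    ∑ S ∈ Finset.powersetCard s (Finset.univ : Finset (Fin n)), Real.exp (-∑ v ∈ S, f v) ≤
      n.choose s * Real.exp ((s : ℝ) / n * ∑ v, (Real.exp (-f v) - 1)) := by
  rcases Nat.eq_zero_or_pos n with rfl | hn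
  · obtain rfl : s = 0 := by omega
    simp
  have hn' : (0 : ℝ) < n := by exact_mod_cast hn
  have hc : ∑ S ∈ Finset.powersetCard s (Finset.univ : Finset (Fin n)),
        Real.exp (-∑ v ∈ S, f v) =
      ∑ S ∈ Finset.powersetCard (n - s) (Finset.univ : Finset (Fin n)),
        Real.exp (-∑ v, f v) * ∏ v ∈ S, (1 + (Real.exp (f v) - 1)) := by
    refine Finset.sum_bij' (fun S _ => Sᶜ) (fun S _ => Sᶜ) ?_ ?_ ?_ ?_ ?_
    · intro S hS
      simp only [Finset.mem_powersetCard, Finset.subset_univ, true_and] at hS ⊢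
      rw [Finset.card_compl, hS, Fintype.card_fin]
    · intro S hS
      simp only [Finset.mem_powersetCard, Finset.subset_univ, true_and] at hS ⊢
      rw [Finset.card_compl, hS, Fintype.card_fin]
      omega
    · simp
    · simp
    · intro S _
      simp only [add_sub_cancel]
      rw [← Real.exp_sum, ← Real.exp_add]
      congr 1
      rw [← Finset.sum_add_sum_compl S]
      ring
  rw [hc, ← Finset.mul_sum]
  have h := sum_powersetCard_prod_le (Nat.sub_le n s) (fun v => Real.exp (f v) - 1)
    (fun v => by linarith [Real.one_le_exp (hf v)])
  rw [Nat.choose_symm hs] at h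
  refine (mul_le_mul_of_nonneg_left h (Real.exp_pos _).le).trans ?_
  rw [← Finset.sum_neg_distrib, Real.exp_sum, mul_left_comm, ← Finset.prod_mul_distrib,
    Finset.mul_sum, Real.exp_sum]
  have hs' : (s : ℝ) / n ≤ 1 := by
    rw [div_le_one hn']
    exact_mod_cast hs
  have hcast : ((n - s : ℕ) : ℝ) / n = 1 - s / n := by
    rw [Nat.cast_sub hs]
    field_simp
  gcongr with v
  · intro v _
    have : 0 ≤ Real.exp (f v) - 1 := by linarith [Real.one_le_exp (hf v)]
    positivity
  · have he : Real.exp (-f v) * Real.exp (f v) = 1 := by rw [← Real.exp_add]; simp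
    -- Absorbing one factor of that constant turns the inclusion probability 1 - s/n of the
    -- complement back into s/n.
    have : Real.exp (-f v) * (1 + ((n - s : ℕ) : ℝ) / n * (Real.exp (f v) - 1)) =
        s / n * (Real.exp (-f v) - 1) + 1 := by
      rw [hcast]
      linear_combination (1 - (s : ℝ) / n) * he
    rw [this]
    exact Real.add_one_le_exp _

theorem exp_sub_one_le_of_mem {x θ : ℝ} (h0 : 0 ≤ x) (h1 : x ≤ 1) :
    Real.exp (θ * x) - 1 ≤ x * (Real.exp θ - 1) := by
  have h := convexOn_exp.2 (Set.mem_univ 0) (Set.mem_univ θ) (sub_nonneg.mpr h1) h0 (by ring)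
  simp only [smul_eq_mul, mul_zero, zero_add, Real.exp_zero, mul_one] at h
  rw [mul_comm θ x]
  linarith

theorem exp_sub_one_le_add_sq {θ : ℝ} (h : |θ| ≤ 1) : Real.exp θ - 1 ≤ θ + θ ^ 2 := by
  have := (abs_le.mp (Real.abs_exp_sub_one_sub_id_le h)).2
  linarith

/-- A multiplicative Chernoff bound for sampling without replacement. -/
theorem randomSample_deviation_le {n s : ℕ} (hs : s ≤ n) (f : Fin n → ℝ)
    (hf : ∀ v, 0 ≤ f v) (hf1 : ∀ v, f v ≤ 1) {γ lam : ℝ} (hγ : 0 ≤ γ) (hγ1 : γ ≤ 1) :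
    (randomSample hs).toMeasure {S | γ * ((s : ℝ) / n * ∑ v, f v + lam) ≤
        |∑ v ∈ S, f v - (s : ℝ) / n * ∑ v, f v|} ≤
      ENNReal.ofReal (2 * Real.exp (-(γ ^ 2 * lam))) := by
  classical
  set μ : ℝ := (s : ℝ) / n * ∑ v, f v with hμ
  have hμ0 : 0 ≤ μ := mul_nonneg (by positivity) (Finset.sum_nonneg fun v _ => hf v)
  set Ps := Finset.powersetCard s (Finset.univ : Finset (Fin n))
  have hcard : (Ps.card : ℝ) = n.choose s := by simp [Ps]
  have hpos : (0 : ℝ) < n.choose s := by exact_mod_cast Nat.choose_pos hs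
  have hbound : ∀ θ : ℝ, |θ| ≤ 1 → (s : ℝ) / n * ∑ v, (Real.exp (θ * f v) - 1) ≤
      μ * (θ + θ ^ 2) := by
    intro θ hθ
    rw [hμ, mul_assoc]
    refine mul_le_mul_of_nonneg_left ?_ (by positivity)
    rw [Finset.sum_mul]
    refine Finset.sum_le_sum fun v _ => (exp_sub_one_le_of_mem (hf v) (hf1 v)).trans ?_
    exact mul_le_mul_of_nonneg_left (exp_sub_one_le_add_sq hθ) (hf v)
  -- Exponential Markov with parameter ±γ, the same number as the relative deviation. By e^θ - 1 ≤ θ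
  -- + θ² the moment costs γ²μ, which the threshold cancels, leaving γ² lam however small μ is.
  have key : ∀ S : Finset (Fin n), γ * (μ + lam) ≤ |∑ v ∈ S, f v - μ| →
      1 ≤ Real.exp (∑ v ∈ S, γ * f v) * Real.exp (-γ * μ - γ ^ 2 * (μ + lam)) +
        Real.exp (-∑ v ∈ S, γ * f v) * Real.exp (γ * μ - γ ^ 2 * (μ + lam)) := by
    intro S hS
    rw [← Real.exp_add, ← Real.exp_add, ← Finset.mul_sum]
    rcases le_abs'.mp hS with h | h
    · have h' : 0 ≤ -(γ * ∑ v ∈ S, f v) + (γ * μ - γ ^ 2 * (μ + lam)) := by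
        nlinarith [mul_le_mul_of_nonneg_left h hγ]
      linarith [Real.one_le_exp h', Real.exp_pos (γ * ∑ v ∈ S, f v + (-γ * μ - γ ^ 2 * (μ + lam)))]
    · have h' : 0 ≤ γ * ∑ v ∈ S, f v + (-γ * μ - γ ^ 2 * (μ + lam)) := by
        nlinarith [mul_le_mul_of_nonneg_left h hγ]
      linarith [Real.one_le_exp h',
        Real.exp_pos (-(γ * ∑ v ∈ S, f v) + (γ * μ - γ ^ 2 * (μ + lam)))]
  have hup := sum_powersetCard_exp_le hs (fun v => γ * f v) (fun v => mul_nonneg hγ (hf v))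
  have hdn := sum_powersetCard_exp_neg_le hs (fun v => γ * f v) (fun v => mul_nonneg hγ (hf v))
  have hup' : Real.exp ((s : ℝ) / n * ∑ v, (Real.exp (γ * f v) - 1)) *
      Real.exp (-γ * μ - γ ^ 2 * (μ + lam)) ≤ Real.exp (-(γ ^ 2 * lam)) := by
    rw [← Real.exp_add]
    refine Real.exp_le_exp.mpr ?_
    have := hbound γ (by rwa [abs_of_nonneg hγ])
    nlinarith
  have hdn' : Real.exp ((s : ℝ) / n * ∑ v, (Real.exp (-(γ * f v)) - 1)) *
      Real.exp (γ * μ - γ ^ 2 * (μ + lam)) ≤ Real.exp (-(γ ^ 2 * lam)) := by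
    rw [← Real.exp_add]
    refine Real.exp_le_exp.mpr ?_
    have := hbound (-γ) (by rwa [abs_neg, abs_of_nonneg hγ])
    simp only [neg_mul] at this
    nlinarith
  have hcount : (((Ps.filter (· ∈ {S | γ * (μ + lam) ≤ |∑ v ∈ S, f v - μ|})).card : ℕ) : ℝ) ≤
      2 * Real.exp (-(γ ^ 2 * lam)) * n.choose s := by
    rw [Finset.card_filter, Nat.cast_sum]
    calc ∑ S ∈ Ps, (((if S ∈ {S | γ * (μ + lam) ≤ |∑ v ∈ S, f v - μ|} then 1 else 0 : ℕ)) : ℝ)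
        ≤ ∑ S ∈ Ps, (Real.exp (∑ v ∈ S, γ * f v) * Real.exp (-γ * μ - γ ^ 2 * (μ + lam)) +
          Real.exp (-∑ v ∈ S, γ * f v) * Real.exp (γ * μ - γ ^ 2 * (μ + lam))) := by
          refine Finset.sum_le_sum fun S _ => ?_
          split_ifs with h
          · simpa using key S h
          · simp only [Nat.cast_zero]; positivity
      _ ≤ (n.choose s * Real.exp ((s : ℝ) / n * ∑ v, (Real.exp (γ * f v) - 1))) *
            Real.exp (-γ * μ - γ ^ 2 * (μ + lam)) +
          (n.choose s * Real.exp ((s : ℝ) / n * ∑ v, (Real.exp (-(γ * f v)) - 1))) *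
            Real.exp (γ * μ - γ ^ 2 * (μ + lam)) := by
          rw [Finset.sum_add_distrib, ← Finset.sum_mul, ← Finset.sum_mul]
          gcongr
      _ ≤ n.choose s * Real.exp (-(γ ^ 2 * lam)) + n.choose s * Real.exp (-(γ ^ 2 * lam)) := by
          rw [mul_assoc, mul_assoc]
          gcongr
      _ = _ := by ring
  rw [randomSample, PMF.toMeasure_uniformOfFinset_apply _ _ (MeasurableSet.of_discrete)]
  rw [ENNReal.div_le_iff (by simpa using (Nat.choose_pos hs).ne') (by simp)]
  rw [← ENNReal.ofReal_natCast, ← ENNReal.ofReal_natCast, ← ENNReal.ofReal_mul (by positivity)]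
  refine ENNReal.ofReal_le_ofReal ?_
  rw [hcard]
  convert hcount

/-! ### Sums of independent bounded variables -/

open ProbabilityTheory in
-- Two-sided Hoeffding: a variable in [0, W] is subgaussian with parameter (W/2)², and the one-sided
-- bound is used for both signs.
theorem pi_deviation_le {ι α : Type*} [Fintype ι] [MeasurableSpace α] [DiscreteMeasurableSpace α]
    (μ : ι → Measure α) [∀ i, IsProbabilityMeasure (μ i)] (g : ι → α → ℝ) (A : Finset ι)
    {W η : ℝ} (hη : 0 ≤ η) (hg : ∀ i a, g i a ∈ Set.Icc 0 W) :
    Measure.pi μ {r | η ≤ |∑ i ∈ A, g i (r i) - ∑ i ∈ A, ∫ a, g i a ∂(μ i)|} ≤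
      ENNReal.ofReal (2 * Real.exp (-(2 * η ^ 2 / (A.card * W ^ 2)))) := by
  have hm : ∀ i, AEMeasurable (g i) (μ i) := fun i => (Measurable.of_discrete).aemeasurable
  have hsub : ∀ i, HasSubgaussianMGF (fun r : ι → α => g i (r i) - ∫ a, g i a ∂(μ i))
      ((‖W - 0‖₊ / 2) ^ 2) (Measure.pi μ) := by
    intro i
    have h := hasSubgaussianMGF_of_mem_Icc (hm i) (Filter.Eventually.of_forall (hg i))
    have hmp := measurePreserving_eval μ i
    refine HasSubgaussianMGF.of_map (Y := fun r : ι → α => r i)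
      (X := fun a => g i a - ∫ a, g i a ∂(μ i)) hmp.measurable.aemeasurable ?_
    have : (Measure.pi μ).map (fun r : ι → α => r i) = μ i := hmp.map_eq
    rw [this]
    exact h
  have hind : iIndepFun (fun i (r : ι → α) => g i (r i) - ∫ a, g i a ∂(μ i)) (Measure.pi μ) :=
    iIndepFun_pi (X := fun i a => g i a - ∫ a, g i a ∂(μ i)) fun i => (hm i).sub_const _
  have hind' : iIndepFun (fun i (r : ι → α) => -(g i (r i) - ∫ a, g i a ∂(μ i))) (Measure.pi μ) :=
    iIndepFun_pi (X := fun i a => -(g i a - ∫ a, g i a ∂(μ i))) fun i => ((hm i).sub_const _).neg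
  have h1 := HasSubgaussianMGF.measure_sum_ge_le_of_iIndepFun hind (s := A)
    (fun i _ => hsub i) hη
  have h2 := HasSubgaussianMGF.measure_sum_ge_le_of_iIndepFun hind' (s := A)
    (fun i _ => (hsub i).neg) hη
  have hexp : -η ^ 2 / (2 * ((∑ i ∈ A, (‖W - 0‖₊ / 2) ^ 2 : NNReal) : ℝ)) =
      -(2 * η ^ 2 / (A.card * W ^ 2)) := by
    simp only [Finset.sum_const, nsmul_eq_mul, sub_zero, NNReal.coe_mul, NNReal.coe_natCast,
      NNReal.coe_pow, NNReal.coe_div, coe_nnnorm, Real.norm_eq_abs, NNReal.coe_ofNat, div_pow,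
      sq_abs]
    rw [neg_div, show (2 : ℝ) * (A.card * (W ^ 2 / 2 ^ 2)) = A.card * W ^ 2 / 2 by ring, div_div_eq_mul_div]
    ring
  rw [hexp] at h1 h2
  have hle : {r : ι → α | η ≤ |∑ i ∈ A, g i (r i) - ∑ i ∈ A, ∫ a, g i a ∂(μ i)|} ⊆
      {r | η ≤ ∑ i ∈ A, (g i (r i) - ∫ a, g i a ∂(μ i))} ∪
      {r | η ≤ ∑ i ∈ A, -(g i (r i) - ∫ a, g i a ∂(μ i))} := by
    intro r hr
    simp only [Set.mem_ofPred_eq, Set.mem_union, Finset.sum_neg_distrib, Finset.sum_sub_distrib] at hr ⊢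
    exact le_abs.mp hr
  refine (measure_mono hle).trans ((measure_union_le _ _).trans ?_)
  rw [two_mul, ENNReal.ofReal_add (Real.exp_pos _).le (Real.exp_pos _).le]
  rw [measureReal_def] at h1 h2
  exact add_le_add ((ENNReal.le_ofReal_iff_toReal_le (measure_ne_top _ _) (Real.exp_pos _).le).mpr h1)
    ((ENNReal.le_ofReal_iff_toReal_le (measure_ne_top _ _) (Real.exp_pos _).le).mpr h2)

/-! ### Random neighbors -/

open scoped Classical in
/-- The number of neighbors of `v` in `C`. -/
def degIn {n : ℕ} (G : SimpleGraph (Fin n)) (C : Finset (Fin n)) (v : Fin n) : ℝ :=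
  ((C.filter fun w => G.Adj v w).card : ℝ)

open scoped Classical in
theorem deg_eq_card_neighborFinset {n : ℕ} (G : SimpleGraph (Fin n)) (v : Fin n) :
    deg G v = (G.neighborFinset v).card := by
  rw [deg, Set.ncard_eq_toFinset_card', SimpleGraph.neighborFinset]

open scoped Classical in
-- For an isolated vertex the answer is ⊥, and the convention 0/0 = 0 gives the matching value.
theorem integral_randomNeighbor {n : ℕ} (G : SimpleGraph (Fin n)) (v : Fin n)
    (C : Finset (Fin n)) :
    ∫ a, (if ∃ w, a = some w ∧ w ∈ C then (1 : ℝ) else 0) ∂(randomNeighbor G v).toMeasure =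
      degIn G C v / deg G v := by
  rw [PMF.integral_eq_sum, Fintype.sum_option]
  simp only [reduceCtorEq, false_and, exists_false, if_false, zero_add,
    Option.some.injEq, exists_eq_left', smul_eq_mul, mul_ite, mul_one, mul_zero]
  rw [deg_eq_card_neighborFinset, randomNeighbor]
  split_ifs with h
  · have : ∀ w, (((PMF.uniformOfFinset (G.neighborFinset v) h).map some) (some w)).toReal =
        if G.Adj v w then ((G.neighborFinset v).card : ℝ)⁻¹ else 0 := by
      intro w
      rw [PMF.map_apply, tsum_eq_single w]
      · simp only [if_true, PMF.uniformOfFinset_apply, SimpleGraph.mem_neighborFinset]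
        split_ifs <;> simp
      · intro b hb
        simp [hb.symm]
    simp_rw [this]
    rw [← Finset.sum_filter, Finset.filter_univ_mem, ← Finset.sum_filter, Finset.sum_const,
      nsmul_eq_mul, degIn, div_eq_mul_inv]
  · rw [Finset.not_nonempty_iff_eq_empty] at h
    simp [h]

/-! ### Counting edges between sets of vertices -/

section Counting

variable {n : ℕ} (G : SimpleGraph (Fin n))

theorem degIn_nonneg (C : Finset (Fin n)) (v : Fin n) : 0 ≤ degIn G C v := Nat.cast_nonneg _

theorem deg_nonneg (v : Fin n) : 0 ≤ deg G v := Nat.cast_nonneg _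

theorem degIn_univ (v : Fin n) : degIn G Finset.univ v = deg G v := by
  classical
  rw [degIn, deg, Set.ncard_eq_toFinset_card']
  congr 2
  ext w
  simp

theorem degIn_mono {C C' : Finset (Fin n)} (h : C ⊆ C') (v : Fin n) :
    degIn G C v ≤ degIn G C' v := by
  classical
  exact Nat.cast_le.mpr (Finset.card_le_card (Finset.filter_subset_filter _ h))

theorem degIn_le_deg (C : Finset (Fin n)) (v : Fin n) : degIn G C v ≤ deg G v :=
  (degIn_mono G (Finset.subset_univ C) v).trans_eq (degIn_univ G v)

theorem degIn_le_card (C : Finset (Fin n)) (v : Fin n) : degIn G C v ≤ C.card := by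
  classical
  exact Nat.cast_le.mpr (Finset.card_filter_le _ _)

theorem degIn_union_le (A B : Finset (Fin n)) (v : Fin n) :
    degIn G (A ∪ B) v ≤ degIn G A v + degIn G B v := by
  classical
  rw [degIn, degIn, degIn, Finset.filter_union]
  exact_mod_cast Finset.card_union_le _ _

theorem sum_degIn_comm (A B : Finset (Fin n)) :
    ∑ v ∈ A, degIn G B v = ∑ w ∈ B, degIn G A w := by
  classical
  simp only [degIn, Finset.card_filter, Nat.cast_sum]
  rw [Finset.sum_comm]
  simp only [G.adj_comm]

theorem deg_le_card (v : Fin n) : deg G v ≤ n := by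
  rw [← degIn_univ]
  simpa using degIn_le_card G Finset.univ v

theorem sum_deg_eq (hn : 0 < n) : ∑ v, deg G v = n * avgDegree G := by
  have : (n : ℝ) ≠ 0 := by positivity
  rw [avgDegree]
  field_simp

/-- By double counting the extra terms are the edges from C into U, which the degrees in C dominate.
-/
theorem sum_deg_add_degIn_le {U C : Finset (Fin n)} (h : Disjoint U C) :
    ∑ v ∈ U, (deg G v + degIn G C v) ≤ ∑ v, deg G v := by
  classical
  rw [Finset.sum_add_distrib, sum_degIn_comm]
  calc ∑ v ∈ U, deg G v + ∑ w ∈ C, degIn G U w ≤ ∑ v ∈ U, deg G v + ∑ w ∈ C, deg G w := by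
        gcongr with w _
        exact degIn_le_deg G U w
    _ = ∑ v ∈ U ∪ C, deg G v := (Finset.sum_union h).symm
    _ ≤ ∑ v, deg G v :=
        Finset.sum_le_sum_of_subset_of_nonneg (Finset.subset_univ _) fun v _ _ => deg_nonneg G v

/-- Split the degrees in C' by the other endpoint: towards U they appear in `degIn`, inside C' there
are at most |C'|² ordered pairs, and towards Q they are paid by the degrees in Q, hence the factor
2. C may be larger than C', as when it also contains the merged vertices. -/
theorem sum_deg_le_sum_deg_add_degIn {U C C' Q : Finset (Fin n)} (hC : C' ⊆ C)
    (hcov : ∀ v, v ∈ U ∨ v ∈ C' ∨ v ∈ Q) :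
    ∑ v, deg G v ≤
      ∑ v ∈ U, (deg G v + degIn G C v) + (C'.card : ℝ) ^ 2 + 2 * ∑ v ∈ Q, deg G v := by
  classical
  have hun : (Finset.univ : Finset (Fin n)) = (U ∪ C') ∪ Q := by
    ext v
    simpa [or_assoc] using hcov v
  have hle : ∀ A B : Finset (Fin n), ∑ v ∈ A ∪ B, deg G v ≤ ∑ v ∈ A, deg G v + ∑ v ∈ B, deg G v := by
    intro A B
    rw [← Finset.sum_union_inter]
    have := Finset.sum_nonneg fun v (_ : v ∈ A ∩ B) => deg_nonneg G v
    linarith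
  have h1 : ∑ v, deg G v ≤ ∑ v ∈ U, deg G v + ∑ v ∈ C', deg G v + ∑ v ∈ Q, deg G v := by
    rw [hun]
    linarith [hle (U ∪ C') Q, hle U C']
  have h2 : ∑ v ∈ C', deg G v ≤
      ∑ v ∈ C', degIn G U v + ∑ v ∈ C', degIn G C' v + ∑ v ∈ C', degIn G Q v := by
    rw [← Finset.sum_add_distrib, ← Finset.sum_add_distrib]
    refine Finset.sum_le_sum fun v _ => ?_
    rw [← degIn_univ, hun]
    linarith [degIn_union_le G (U ∪ C') Q v, degIn_union_le G U C' v]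
  have h3 : ∑ v ∈ C', degIn G U v ≤ ∑ v ∈ U, degIn G C v := by
    rw [sum_degIn_comm]
    exact Finset.sum_le_sum fun v _ => degIn_mono G hC v
  have h4 : ∑ v ∈ C', degIn G C' v ≤ (C'.card : ℝ) ^ 2 := by
    rw [sq, ← nsmul_eq_mul]
    exact Finset.sum_le_card_nsmul _ _ _ fun v _ => degIn_le_card G C' v
  have h5 : ∑ v ∈ C', degIn G Q v ≤ ∑ v ∈ Q, deg G v := by
    rw [sum_degIn_comm]
    exact Finset.sum_le_sum fun v _ => degIn_le_deg G C' v
  rw [Finset.sum_add_distrib]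
  linarith

/-- The fraction of the neighbors of `v` that lie in `C`. -/
def fracIn (C : Finset (Fin n)) (v : Fin n) : ℝ := degIn G C v / deg G v

theorem fracIn_nonneg (C : Finset (Fin n)) (v : Fin n) : 0 ≤ fracIn G C v :=
  div_nonneg (degIn_nonneg G C v) (deg_nonneg G v)

theorem fracIn_le_one (C : Finset (Fin n)) (v : Fin n) : fracIn G C v ≤ 1 :=
  div_le_one_of_le₀ (degIn_le_deg G C v) (deg_nonneg G v)

theorem deg_mul_fracIn (C : Finset (Fin n)) (v : Fin n) :
    deg G v * fracIn G C v = degIn G C v := by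
  rcases (deg_nonneg G v).eq_or_lt with h | h
  · have h1 := degIn_le_deg G C v
    have h2 := degIn_nonneg G C v
    rw [← h] at h1 ⊢
    linarith
  · rw [fracIn]
    field_simp

end Counting

/-! ### Bucket labels -/

section Labels

variable (P : Params) (n : ℕ)

/-- The index of the bucket of a noisy degree; `⌊cutoff⌋` stands for the merged bucket. -/
def label (x : ℝ) : ℤ :=
  open scoped Classical in
  if P.InMerged n x then ⌊P.cutoff n⌋ else ⌈Real.logb (1 + P.β) x⌉

variable {P n}

theorem measurable_label : Measurable (label P n) := by
  refine Measurable.ite (measurableSet_Iic (a := (1 + P.β) ^ ⌊P.cutoff n⌋)) measurable_const ?_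
  have : Measurable fun x : ℝ => Real.logb (1 + P.β) x := by
    unfold Real.logb
    fun_prop
  exact this.ceil

theorem inBucket_iff_ceil (hβ : 0 < P.β) {x : ℝ} (hx : 0 < x) (i : ℤ) :
    P.InBucket i x ↔ ⌈Real.logb (1 + P.β) x⌉ = i := by
  have h1 : 1 < 1 + P.β := by linarith
  rw [Int.ceil_eq_iff, Params.InBucket, Real.lt_logb_iff_rpow_lt h1 hx,
    Real.logb_le_iff_le_rpow h1 hx, ← Int.cast_one (R := ℝ), ← Int.cast_sub, Real.rpow_intCast,
    Real.rpow_intCast]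

theorem lt_label_of_not_inMerged (hβ : 0 < P.β) {x : ℝ} (h : ¬ P.InMerged n x) :
    ⌊P.cutoff n⌋ < label P n x := by
  have h1 : 1 < 1 + P.β := by linarith
  have h2 : (1 + P.β) ^ ⌊P.cutoff n⌋ < x := not_le.mp h
  have hx : 0 < x := lt_trans (by positivity) h2
  rw [label, if_neg h, Int.lt_ceil, Real.lt_logb_iff_rpow_lt h1 hx, Real.rpow_intCast]
  exact h2

theorem label_eq_cutoff_iff (hβ : 0 < P.β) (x : ℝ) :
    label P n x = ⌊P.cutoff n⌋ ↔ P.InMerged n x := by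
  refine ⟨fun h => ?_, fun h => if_pos h⟩
  by_contra h'
  exact (lt_label_of_not_inMerged hβ h').ne' h

theorem cutoff_le_label (hβ : 0 < P.β) (x : ℝ) : ⌊P.cutoff n⌋ ≤ label P n x := by
  by_cases h : P.InMerged n x
  · exact ((label_eq_cutoff_iff hβ x).mpr h).ge
  · exact (lt_label_of_not_inMerged hβ h).le

/-- Labels and buckets agree only above the cutoff; everything below, nonpositive values included,
shares the label ⌊cutoff⌋. -/
theorem inBucket_iff_label (hβ : 0 < P.β) {x : ℝ} {i : ℤ} (hi : ⌊P.cutoff n⌋ < i) :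
    P.InBucket i x ↔ label P n x = i := by
  have h1 : 1 < 1 + P.β := by linarith
  by_cases h : P.InMerged n x
  · rw [(label_eq_cutoff_iff hβ x).mpr h]
    refine iff_of_false (fun hb => ?_) hi.ne
    have h2 : (1 + P.β) ^ ⌊P.cutoff n⌋ ≤ (1 + P.β) ^ (i - 1) :=
      zpow_le_zpow_right₀ h1.le (by omega)
    have h3 : x ≤ (1 + P.β) ^ ⌊P.cutoff n⌋ := h
    linarith [hb.1]
  · have h2 : (1 + P.β) ^ ⌊P.cutoff n⌋ < x := not_le.mp h
    rw [inBucket_iff_ceil hβ (lt_trans (by positivity) h2), label, if_neg h]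

theorem inMerged_of_inBucket (hβ : 0 < P.β) {x : ℝ} {i : ℤ} (hi : i ≤ ⌊P.cutoff n⌋)
    (h : P.InBucket i x) : P.InMerged n x :=
  h.2.trans (zpow_le_zpow_right₀ (by linarith) hi)

/-! ### The algorithm in terms of labels -/

variable {d : Fin n → ℝ} {S : Finset (Fin n)}

variable (P) in
/-- The labels of all vertices. -/
def labels (d : Fin n → ℝ) (v : Fin n) : ℤ := label P n (d v)

/-- The vertices of the sample with label `i`. -/
def cell (κ : Fin n → ℤ) (S : Finset (Fin n)) (i : ℤ) : Finset (Fin n) := S.filter fun v => κ v = i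

variable (P) in
/-- The indices of big buckets. -/
def bigLabels (κ : Fin n → ℤ) (S : Finset (Fin n)) : Set ℤ :=
  {i | ⌊P.cutoff n⌋ < i ∧ 1.2 * P.T n * S.card ≤ (cell κ S i).card}

open scoped Classical in
/-- The vertices whose label is not in `J`. -/
def smallVertices (κ : Fin n → ℤ) (J : Set ℤ) : Finset (Fin n) := Finset.univ.filter fun w => κ w ∉ J

variable (P) in
open scoped Classical in
/-- The vertices whose label is not in `J` and exceeds `ceilCutoff`. -/
def smallUnmergedVertices (κ : Fin n → ℤ) (J : Set ℤ) : Finset (Fin n) :=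
  Finset.univ.filter fun w => κ w ∉ J ∧ P.ceilCutoff n < κ w

variable (P) in
/-- `S₁` is small, in terms of labels. -/
def MergedCellSmall (κ : Fin n → ℤ) (S : Finset (Fin n)) : Prop :=
  ((cell κ S ⌊P.cutoff n⌋).card : ℝ) < 1.2 * P.T n * √(S.card : ℝ) * S.card

variable (P) in
open scoped Classical in
/-- The set of vertices counted by `edgeIndicator`. -/
def countedVertices (κ : Fin n → ℤ) (S : Finset (Fin n)) : Finset (Fin n) :=
  if MergedCellSmall P κ S then smallVertices κ (bigLabels P κ S)
  else smallUnmergedVertices P κ (bigLabels P κ S)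

theorem sampleBucket_eq_cell (hβ : 0 < P.β) {i : ℤ} (hi : ⌊P.cutoff n⌋ < i) :
    sampleBucket P d S i = cell (labels P d) S i := by
  classical
  ext v
  rw [sampleBucket, cell, Finset.mem_filter, Finset.mem_filter, inBucket_iff_label hβ hi, labels]

theorem mergedSample_eq_cell (hβ : 0 < P.β) :
    mergedSample P d S = cell (labels P d) S ⌊P.cutoff n⌋ := by
  classical
  ext v
  rw [mergedSample, cell, Finset.mem_filter, Finset.mem_filter, ← label_eq_cutoff_iff hβ, labels]

theorem bigIndices_eq (hβ : 0 < P.β) : bigIndices P d S = bigLabels P (labels P d) S := by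
  ext i
  simp only [bigIndices, bigLabels, Set.mem_ofPred_eq, Int.floor_lt]
  refine and_congr_right fun h => ?_
  rw [sampleBucket_eq_cell hβ (Int.floor_lt.mpr h)]

theorem mergedSmall_iff (hβ : 0 < P.β) :
    MergedSmall P d S ↔ MergedCellSmall P (labels P d) S := by
  rw [MergedSmall, MergedCellSmall, mergedSample_eq_cell hβ]

theorem inSmall_iff (hβ : 0 < P.β) (w : Fin n) :
    InSmall P d S w ↔ w ∈ smallVertices (labels P d) (bigLabels P (labels P d) S) := by
  classical
  simp only [InSmall, smallVertices, Finset.mem_filter, Finset.mem_univ, true_and,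
    bigIndices_eq hβ]
  by_cases h : P.InMerged n (d w)
  · refine iff_of_true (Or.inl h) fun h' => ?_
    exact h'.1.ne' ((label_eq_cutoff_iff hβ _).mpr h)
  · have h1 := lt_label_of_not_inMerged hβ h
    simp only [h, false_or]
    constructor
    · rintro ⟨i, hi, hb⟩
      by_cases hic : ⌊P.cutoff n⌋ < i
      · rw [inBucket_iff_label hβ hic] at hb
        rwa [labels, hb]
      · exact absurd (inMerged_of_inBucket hβ (not_lt.mp hic) hb) h
    · intro hw
      exact ⟨_, hw, (inBucket_iff_label hβ h1).mpr rfl⟩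

theorem inSmallUnmerged_iff (hβ : 0 < P.β) (hL : P.cutoff n ≤ P.ceilCutoff n) (w : Fin n) :
    InSmallUnmerged P d S w ↔
      w ∈ smallUnmergedVertices P (labels P d) (bigLabels P (labels P d) S) := by
  classical
  simp only [InSmallUnmerged, smallUnmergedVertices, Finset.mem_filter, Finset.mem_univ, true_and,
    bigIndices_eq hβ]
  constructor
  · rintro ⟨i, hi, hi', hb⟩
    rw [inBucket_iff_label hβ (Int.floor_lt.mpr (hL.trans_lt hi'))] at hb
    rw [labels, hb]
    exact ⟨hi, hi'⟩
  · rintro ⟨hw, hw'⟩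
    exact ⟨_, hw, hw', (inBucket_iff_label hβ (Int.floor_lt.mpr (hL.trans_lt hw'))).mpr rfl⟩

open scoped Classical in
/-- The indicator of the event that the neighbor `a` exists and lies in `C`. -/
def hit (C : Finset (Fin n)) (a : Option (Fin n)) : ℝ := if ∃ w, a = some w ∧ w ∈ C then 1 else 0

theorem hit_nonneg (C : Finset (Fin n)) (a : Option (Fin n)) : 0 ≤ hit C a := by
  rw [hit]; split_ifs <;> norm_num

theorem hit_le_one (C : Finset (Fin n)) (a : Option (Fin n)) : hit C a ≤ 1 := by
  rw [hit]; split_ifs <;> norm_num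

theorem integral_hit (G : SimpleGraph (Fin n)) (C : Finset (Fin n)) (v : Fin n) :
    ∫ a, hit C a ∂(randomNeighbor G v).toMeasure = fracIn G C v := by
  classical
  rw [fracIn, ← integral_randomNeighbor]
  simp only [hit]

theorem mergedEdgeIndicator_eq_hit (hβ : 0 < P.β) (hL : P.cutoff n ≤ P.ceilCutoff n)
    (a : Option (Fin n)) :
    mergedEdgeIndicator P d S a =
      hit (smallUnmergedVertices P (labels P d) (bigLabels P (labels P d) S)) a := by
  simp only [mergedEdgeIndicator, hit, inSmallUnmerged_iff hβ hL]

theorem edgeIndicator_eq_hit (hβ : 0 < P.β) (hL : P.cutoff n ≤ P.ceilCutoff n)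
    (a : Option (Fin n)) :
    edgeIndicator P d S a = hit (countedVertices P (labels P d) S) a := by
  have h : ∀ w, (MergedSmall P d S ∧ InSmall P d S w) ∨ (¬ MergedSmall P d S ∧
      InSmallUnmerged P d S w) ↔ w ∈ countedVertices P (labels P d) S := by
    intro w
    rw [inSmallUnmerged_iff hβ hL, inSmall_iff hβ, mergedSmall_iff hβ, countedVertices]
    by_cases h : MergedCellSmall P (labels P d) S <;> simp [h]
  simp only [edgeIndicator, hit, h]

end Labels

/-! ### Numerical regime -/

/-- The inequalities between the parameters that hold for large `n`. -/
structure Regime (P : Params) (n : ℕ) (γ N : ℝ) : Prop where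
  n_pos : 0 < n
  β_pos : 0 < P.β
  ρ_pos : 0 < P.ρ
  ρ_lt : P.ρ < 1 / 4
  β_le : P.β ≤ P.ρ / 8
  γ_eq : γ = P.ρ / 100
  s_pos : 0 < P.sampleSize n
  one_le_lam : 1 ≤ Real.log n ^ 2
  lam_le : 4 * Real.log n ^ 2 ≤ 1.2 * P.T n * P.sampleSize n
  one_le_M : 1 ≤ P.M n
  N_le_M : N ≤ γ * P.M n
  N_le_n : N ≤ n
  T_le : P.t n * P.T n ≤ 1 / 2 * √(P.ρ / n)
  n_le : (n : ℝ) ≤ (1 + P.β) ^ P.t n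
  clamp_lam_le : 2 * P.clamp n * Real.log n ^ 2 ≤ P.sampleSize n
  T_sqrt_le : 3 * P.T n * √(P.sampleSize n : ℝ) * P.clamp n ≤ γ
  sqrt_clamp_le : 2 * √(n : ℝ) * P.clamp n ≤ γ * n

namespace Regime

variable {P : Params} {n : ℕ} {γ N : ℝ} (h : Regime P n γ N)
include h

theorem γ_pos : 0 < γ := by rw [h.γ_eq]; linarith [h.ρ_pos]

theorem γ_le : γ ≤ 1 / 400 := by rw [h.γ_eq]; linarith [h.ρ_lt]

theorem one_lt : 1 < 1 + P.β := by linarith [h.β_pos]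

theorem M_div_pos : 0 < 6 * P.M n / P.β := by
  have := h.one_le_M
  have := h.β_pos
  positivity

theorem rpow_cutoff : (1 + P.β) ^ P.cutoff n = 6 * P.M n / P.β * (1 + P.β) ^ 2 := by
  have h1 := h.one_lt
  rw [Params.cutoff, Real.rpow_add (by linarith),
    Real.rpow_logb (by linarith) h1.ne' h.M_div_pos, Real.rpow_two]

theorem zpow_floor_cutoff_le :
    (1 + P.β) ^ ⌊P.cutoff n⌋ ≤ 6 * P.M n / P.β * (1 + P.β) ^ 2 := by
  rw [← h.rpow_cutoff, ← Real.rpow_intCast]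
  exact Real.rpow_le_rpow_of_exponent_le h.one_lt.le (Int.floor_le _)

theorem le_zpow_floor_cutoff : 6 * P.M n / P.β * (1 + P.β) ≤ (1 + P.β) ^ ⌊P.cutoff n⌋ := by
  have h1 := h.one_lt
  have h2 : (1 + P.β) ^ (P.cutoff n - 1) ≤ (1 + P.β) ^ ⌊P.cutoff n⌋ := by
    rw [← Real.rpow_intCast]
    exact Real.rpow_le_rpow_of_exponent_le h1.le (Int.sub_one_lt_floor _).le
  refine le_trans (le_of_eq ?_) h2
  rw [Real.rpow_sub (by linarith), h.rpow_cutoff, Real.rpow_one]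
  field_simp

theorem six_M_le_zpow : 6 * P.M n ≤ (1 + P.β) ^ ⌊P.cutoff n⌋ := by
  refine le_trans ?_ h.le_zpow_floor_cutoff
  have hβ := h.β_pos
  have := h.one_le_M
  rw [div_mul_eq_mul_div, le_div_iff₀ hβ]
  nlinarith

theorem cutoff_le_ceilCutoff : P.cutoff n ≤ P.ceilCutoff n := by
  rw [Params.cutoff, Params.ceilCutoff]
  gcongr
  · exact h.one_lt
  · exact h.M_div_pos
  · exact Int.le_ceil _

theorem zpow_le_of_le_ceilCutoff {i : ℤ} (hi : (i : ℝ) ≤ P.ceilCutoff n) :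
    (1 + P.β) ^ i ≤ (6 * P.M n / P.β + 1) * (1 + P.β) ^ 2 := by
  have h1 := h.one_lt
  have h0 := h.M_div_pos
  have hc := Int.ceil_lt_add_one (6 * P.M n / P.β)
  have hc' := Int.le_ceil (6 * P.M n / P.β)
  rw [← Real.rpow_intCast]
  refine (Real.rpow_le_rpow_of_exponent_le h1.le hi).trans ?_
  rw [Params.ceilCutoff, Real.rpow_add (by linarith),
    Real.rpow_logb (by linarith) h1.ne' (by linarith), Real.rpow_two]
  gcongr

theorem T_pos : 0 < P.T n := by
  by_contra hT
  have h1 := h.lam_le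
  have h2 := h.one_le_lam
  have h3 : (0 : ℝ) ≤ P.sampleSize n := Nat.cast_nonneg _
  nlinarith

/-- Since (6M/β)(1+β)² = 6M(2 + β + 1/β), the clamp leaves room 6M, enough for the term (1+β)² due
to the ceiling and for the noise N ≤ M. -/
theorem le_clamp : (6 * P.M n / P.β + 1) * (1 + P.β) ^ 2 + N ≤ P.clamp n := by
  have hβ := h.β_pos
  have hM := h.one_le_M
  have hβ1 : P.β ≤ 1 / 32 := by linarith [h.β_le, h.ρ_lt]
  have hN : N ≤ P.M n := h.N_le_M.trans (by nlinarith [h.γ_le])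
  have e : 6 * P.M n / P.β * (1 + P.β) ^ 2 = 6 * P.M n * (2 + P.β + 1 / P.β) := by
    field_simp; ring
  rw [add_mul, e, Params.clamp]
  nlinarith

theorem clamp_pos : 0 < P.clamp n := by
  have hβ := h.β_pos
  have hM := h.one_le_M
  rw [Params.clamp]
  positivity

end Regime

/-! ### Noisy degrees -/

section NoisyDegrees

variable {P : Params} {n : ℕ} {γ N : ℝ} {G : SimpleGraph (Fin n)} {Y : Fin n → ℝ}

theorem deg_le_noisyDegree_add (hY : ∀ v, |Y v| ≤ N) (v : Fin n) :
    deg G v ≤ noisyDegree G Y v + N := by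
  rw [noisyDegree]
  linarith [(abs_le.mp (hY v)).1]

theorem noisyDegree_le_deg_add (hY : ∀ v, |Y v| ≤ N) (v : Fin n) :
    noisyDegree G Y v ≤ deg G v + N := by
  rw [noisyDegree]
  linarith [(abs_le.mp (hY v)).2]

variable (h : Regime P n γ N) (hY : ∀ v, |Y v| ≤ N)
include h hY

/-- A window of t labels suffices: its upper end is at least 6M·n ≥ 6n, while noisy degrees are at
most n + N ≤ 2n. -/
theorem label_le (v : Fin n) : labels P (noisyDegree G Y) v ≤ ⌊P.cutoff n⌋ + P.t n := by
  have h1 := h.one_lt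
  by_contra! hlt
  have hc : ⌊P.cutoff n⌋ < labels P (noisyDegree G Y) v := by omega
  have hb := (inBucket_iff_label (x := noisyDegree G Y v) h.β_pos hc).mpr rfl
  have h2 : (1 + P.β) ^ (⌊P.cutoff n⌋ + P.t n) ≤
      (1 + P.β) ^ (labels P (noisyDegree G Y) v - 1) :=
    zpow_le_zpow_right₀ h1.le (by omega)
  rw [zpow_add₀ (by linarith), zpow_natCast] at h2
  have h3 : 6 * (n : ℝ) ≤ (1 + P.β) ^ ⌊P.cutoff n⌋ * (1 + P.β) ^ P.t n := by
    have := h.six_M_le_zpow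
    have := h.one_le_M
    have := h.n_le
    have : (0 : ℝ) ≤ n := Nat.cast_nonneg _
    gcongr
    linarith
  have h4 : (0 : ℝ) < n := by exact_mod_cast h.n_pos
  linarith [hb.1, noisyDegree_le_deg_add hY (G := G) v, deg_le_card G v, h.N_le_n]

theorem zpow_label_bounds {v : Fin n} {i : ℤ} (hi : ⌊P.cutoff n⌋ < i)
    (hv : labels P (noisyDegree G Y) v = i) :
    (1 - γ) * deg G v ≤ (1 + P.β) ^ i ∧
      (1 + P.β) ^ i ≤ (1 + P.β) * (1 + γ) * deg G v := by
  have h1 := h.one_lt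
  have hγ := h.γ_pos
  have hγ1 := h.γ_le
  have hb := (inBucket_iff_label (x := noisyDegree G Y v) h.β_pos hi).mpr hv
  have h6 : 6 * P.M n ≤ noisyDegree G Y v := by
    have : (1 + P.β) ^ ⌊P.cutoff n⌋ ≤ (1 + P.β) ^ (i - 1) :=
      zpow_le_zpow_right₀ h1.le (by omega)
    linarith [hb.1, h.six_M_le_zpow]
  have hM := h.one_le_M
  have hN : N ≤ γ * noisyDegree G Y v / 6 := by
    have := h.N_le_M
    nlinarith
  have h2 := deg_le_noisyDegree_add hY (G := G) v
  have h3 := noisyDegree_le_deg_add hY (G := G) v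
  have hz : (1 + P.β) ^ i = (1 + P.β) * (1 + P.β) ^ (i - 1) := by
    rw [← zpow_one_add₀ (by linarith)]
    congr 1
    ring
  set d := noisyDegree G Y v
  constructor
  · refine le_trans ?_ hb.2
    nlinarith
  · rw [hz, mul_assoc]
    refine mul_le_mul_of_nonneg_left (hb.1.le.trans ?_) (by linarith)
    have : 0 < γ * d := mul_pos hγ (by linarith)
    nlinarith

/-- This range covers the merged bucket and also the buckets between the two cutoffs, which
`smallUnmergedVertices` leaves out. -/
theorem deg_le_clamp_of_label {v : Fin n} (hv : (labels P (noisyDegree G Y) v : ℝ) ≤ P.ceilCutoff n) :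
    deg G v ≤ P.clamp n := by
  have h1 := h.one_lt
  refine le_trans ?_ h.le_clamp
  refine (deg_le_noisyDegree_add hY (G := G) v).trans ?_
  gcongr
  by_cases hm : P.InMerged n (noisyDegree G Y v)
  · refine (show noisyDegree G Y v ≤ (1 + P.β) ^ ⌊P.cutoff n⌋ from hm).trans ?_
    refine h.zpow_floor_cutoff_le.trans ?_
    gcongr
    linarith
  · have hb := (inBucket_iff_label h.β_pos (lt_label_of_not_inMerged h.β_pos hm)).mpr rfl
    exact hb.2.trans (h.zpow_le_of_le_ceilCutoff hv)

theorem deg_le_clamp_of_merged {v : Fin n} (hv : labels P (noisyDegree G Y) v = ⌊P.cutoff n⌋) :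
    deg G v ≤ P.clamp n := by
  refine deg_le_clamp_of_label h hY ?_
  rw [hv]
  exact (Int.floor_le _).trans h.cutoff_le_ceilCutoff

end NoisyDegrees

/-! ### Typical samples -/

/-- The sum of `w` over the sampled part of cell `i` is close to its expectation. -/
def IsTypical (P : Params) {n : ℕ} (γ : ℝ) (κ : Fin n → ℤ) (S : Finset (Fin n)) (i : ℤ)
    (w : Fin n → ℝ) : Prop :=
  |∑ v ∈ cell κ S i, w v - (P.sampleSize n : ℝ) / n * ∑ v ∈ cell κ Finset.univ i, w v| ≤
    γ * ((P.sampleSize n : ℝ) / n * ∑ v ∈ cell κ Finset.univ i, w v + Real.log n ^ 2)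

/-- The sets of vertices that the algorithm may count as small, if `J` is the set of big labels. -/
def candidate (P : Params) {n : ℕ} (κ : Fin n → ℤ) (J : Finset ℤ) (b : Bool) : Finset (Fin n) :=
  if b then smallVertices κ J else smallUnmergedVertices P κ J

/-- The clamped degree, scaled to the unit interval. -/
def scaledDeg (P : Params) {n : ℕ} (G : SimpleGraph (Fin n)) (v : Fin n) : ℝ :=
  clampedDeg P G v / P.clamp n

/-- The sample represents all the weights that matter for the analysis. -/
structure SampleGood (P : Params) {n : ℕ} (G : SimpleGraph (Fin n)) (γ : ℝ) (κ : Fin n → ℤ)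
    (S : Finset (Fin n)) : Prop where
  card_eq : S.card = P.sampleSize n
  size : ∀ i ∈ Finset.Icc ⌊P.cutoff n⌋ (⌊P.cutoff n⌋ + P.t n), IsTypical P γ κ S i 1
  deg : ∀ i ∈ Finset.Icc ⌊P.cutoff n⌋ (⌊P.cutoff n⌋ + P.t n), IsTypical P γ κ S i (scaledDeg P G)
  frac : ∀ i ∈ Finset.Icc ⌊P.cutoff n⌋ (⌊P.cutoff n⌋ + P.t n),
    ∀ J ∈ (Finset.Ioc ⌊P.cutoff n⌋ (⌊P.cutoff n⌋ + P.t n)).powerset, ∀ b,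
      IsTypical P γ κ S i (fracIn G (candidate P κ J b))
  deg_frac : ∀ i ∈ Finset.Icc ⌊P.cutoff n⌋ (⌊P.cutoff n⌋ + P.t n),
    ∀ J ∈ (Finset.Ioc ⌊P.cutoff n⌋ (⌊P.cutoff n⌋ + P.t n)).powerset, ∀ b,
      IsTypical P γ κ S i fun v => scaledDeg P G v * fracIn G (candidate P κ J b) v

/-- The random neighbors behave like their averages. -/
structure NeighborsGood (P : Params) {n : ℕ} (G : SimpleGraph (Fin n)) (γ : ℝ) (κ : Fin n → ℤ)
    (S : Finset (Fin n)) (r r' : Fin n → Option (Fin n)) : Prop where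
  big : ∀ i ∈ Finset.Ioc ⌊P.cutoff n⌋ (⌊P.cutoff n⌋ + P.t n), i ∈ bigLabels P κ S →
    |∑ v ∈ cell κ S i, hit (countedVertices P κ S) (r v) -
      ∑ v ∈ cell κ S i, fracIn G (countedVertices P κ S) v| ≤ γ * (cell κ S i).card
  merged : |∑ v ∈ cell κ S ⌊P.cutoff n⌋, clampedDeg P G v *
        hit (smallUnmergedVertices P κ (bigLabels P κ S)) (r' v) -
      ∑ v ∈ cell κ S ⌊P.cutoff n⌋, clampedDeg P G v *
        fracIn G (smallUnmergedVertices P κ (bigLabels P κ S)) v| ≤ γ * P.sampleSize n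

/-- All the coins behave as expected. -/
structure Good (P : Params) {n : ℕ} (G : SimpleGraph (Fin n)) (γ N : ℝ) (c : Coins n) : Prop where
  noise : ∀ v, |c.1.2 v| ≤ N
  noise_big : ∀ i ∈ Finset.Ioc ⌊P.cutoff n⌋ (⌊P.cutoff n⌋ + P.t n),
    |c.2.1.2 i| ≤ γ * Real.log n ^ 2
  noise_merged : |c.2.2.2| ≤ γ * P.sampleSize n
  sample : SampleGood P G γ (labels P (noisyDegree G c.1.2)) c.1.1
  neighbors : NeighborsGood P G γ (labels P (noisyDegree G c.1.2)) c.1.1 c.2.1.1 c.2.2.1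

/-! ### Accuracy of the estimates on good coins -/

/-- Here a, b are the sampled and expected bucket sizes, p, q the sampled and expected sums of
fractions, x the hits and z the noise. As a ≥ 4 lam forces b ≥ 3 lam, the three additive lam errors
cost at most γb together, and the total is little more than 4γb. -/
theorem abs_estimate_le {a b p q x z γ lam : ℝ} (hγ : 0 ≤ γ) (hγ1 : γ ≤ 1 / 100) (hlam : 0 ≤ lam)
    (ha : 4 * lam ≤ a) (hab : |a - b| ≤ γ * (b + lam)) (hq : q ≤ b) (hq0 : 0 ≤ q)
    (hpq : |p - q| ≤ γ * (q + lam)) (hx : |x - p| ≤ γ * a) (hz : |z| ≤ γ * lam) :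
    |a + x + z - (b + q)| ≤ 5 * γ * b := by
  have hb : 0 ≤ b := hq0.trans hq
  rw [abs_le] at *
  have h1 : γ * b ≤ 1 / 100 * b := by gcongr
  have h2 : γ * lam ≤ 1 / 100 * lam := by gcongr
  have h3 : lam ≤ b / 3 := by linarith [hab.2]
  have h4 : a ≤ 1.02 * b := by linarith [hab.2]
  have h5 : γ * lam ≤ γ * (b / 3) := by gcongr
  have h6 : γ * q ≤ γ * b := by gcongr
  have h7 : γ * a ≤ γ * (1.02 * b) := by gcongr
  have h8 : 0 ≤ γ * b := by positivity
  constructor <;> linarith [hab.1, hab.2, hpq.1, hpq.2, hx.1, hx.2, hz.1, hz.2]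

/-- The estimate for a big bucket is correct up to constant factors close to one. -/
theorem bucket_term_bounds {P : Params} {n : ℕ} {γ N : ℝ} (h : Regime P n γ N)
    {G : SimpleGraph (Fin n)} {κ : Fin n → ℤ} {S C : Finset (Fin n)} {i : ℤ} {u x z : ℝ}
    (hu0 : 0 ≤ u)
    (hu : ∀ v ∈ cell κ Finset.univ i, (1 - γ) * deg G v ≤ u ∧ u ≤ (1 + P.β) * (1 + γ) * deg G v)
    (ha : 4 * Real.log n ^ 2 ≤ (cell κ S i).card)
    (hsize : IsTypical P γ κ S i 1) (hfrac : IsTypical P γ κ S i (fracIn G C))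
    (hx : |x - ∑ v ∈ cell κ S i, fracIn G C v| ≤ γ * (cell κ S i).card)
    (hz : |z| ≤ γ * Real.log n ^ 2) :
    (1 - 5 * γ) * (1 - γ) * ((P.sampleSize n : ℝ) / n *
        ∑ v ∈ cell κ Finset.univ i, (deg G v + degIn G C v)) ≤
      ((cell κ S i).card + x + z) * u ∧
    ((cell κ S i).card + x + z) * u ≤
      (1 + 5 * γ) * ((1 + P.β) * (1 + γ)) * ((P.sampleSize n : ℝ) / n *
        ∑ v ∈ cell κ Finset.univ i, (deg G v + degIn G C v)) := by
  have hγ := h.γ_pos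
  have hγ1 := h.γ_le
  have hs0 : 0 ≤ (P.sampleSize n : ℝ) / n := by positivity
  set σ := (P.sampleSize n : ℝ) / n
  set B := cell κ Finset.univ i
  simp only [IsTypical, Pi.one_apply, Finset.sum_const, nsmul_eq_mul, mul_one] at hsize
  have hsum_le : ∑ v ∈ B, fracIn G C v ≤ B.card := by
    simpa using Finset.sum_le_card_nsmul B _ 1 fun v _ => fracIn_le_one G C v
  have hsum0 : 0 ≤ ∑ v ∈ B, fracIn G C v := Finset.sum_nonneg fun v _ => fracIn_nonneg G C v
  have key := abs_estimate_le hγ.le (by linarith) (sq_nonneg _) ha hsize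
    (mul_le_mul_of_nonneg_left hsum_le hs0) (mul_nonneg hs0 hsum0) hfrac hx hz
  rw [abs_le] at key
  have hbq : σ * B.card + σ * ∑ v ∈ B, fracIn G C v = σ * ∑ v ∈ B, (1 + fracIn G C v) := by
    rw [Finset.sum_add_distrib]
    simp
    ring
  rw [hbq] at key
  have hbF : σ * B.card ≤ σ * ∑ v ∈ B, (1 + fracIn G C v) := by
    rw [← hbq]
    have := mul_nonneg hs0 hsum0
    linarith
  set Q := σ * ∑ v ∈ B, (1 + fracIn G C v) with hQ
  -- The common value u is comparable with each degree separately, so a correlation between degrees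
  -- and fractions within the bucket does no harm.
  have hF : ∀ v, deg G v + degIn G C v = deg G v * (1 + fracIn G C v) := by
    intro v
    rw [mul_add, mul_one, deg_mul_fracIn]
  have hup : Q * u ≤ (1 + P.β) * (1 + γ) * (σ * ∑ v ∈ B, (deg G v + degIn G C v)) := by
    rw [hQ, mul_assoc, Finset.sum_mul, mul_left_comm, Finset.mul_sum B _ (_ * _)]
    refine mul_le_mul_of_nonneg_left (Finset.sum_le_sum fun v hv => ?_) hs0
    rw [hF, ← mul_assoc, mul_comm]
    exact mul_le_mul_of_nonneg_right (hu v hv).2 (by linarith [fracIn_nonneg G C v])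
  have hdn : (1 - γ) * (σ * ∑ v ∈ B, (deg G v + degIn G C v)) ≤ Q * u := by
    rw [hQ, mul_assoc, Finset.sum_mul, mul_left_comm, Finset.mul_sum B _ (1 - γ)]
    refine mul_le_mul_of_nonneg_left (Finset.sum_le_sum fun v hv => ?_) hs0
    rw [hF, ← mul_assoc, mul_comm (1 + _) u]
    exact mul_le_mul_of_nonneg_right (hu v hv).1 (by linarith [fracIn_nonneg G C v])
  have hγb : 5 * γ * (σ * B.card) ≤ 5 * γ * Q := by gcongr
  constructor
  · rw [mul_assoc]
    refine (mul_le_mul_of_nonneg_left hdn (by linarith)).trans ?_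
    rw [← mul_assoc]
    exact mul_le_mul_of_nonneg_right (by linarith) hu0
  · rw [mul_assoc]
    refine le_trans ?_ (mul_le_mul_of_nonneg_left hup (by linarith))
    rw [← mul_assoc]
    exact mul_le_mul_of_nonneg_right (by linarith) hu0

/-- A cell with few sampled vertices is small. -/
theorem card_cell_le {P : Params} {n : ℕ} {γ N : ℝ} (h : Regime P n γ N)
    {κ : Fin n → ℤ} {S : Finset (Fin n)} {i : ℤ} {x : ℝ} (hsize : IsTypical P γ κ S i 1)
    (ha : ((cell κ S i).card : ℝ) ≤ x * P.sampleSize n) (hx : Real.log n ^ 2 ≤ x * P.sampleSize n) :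
    ((cell κ Finset.univ i).card : ℝ) ≤ 1.02 * x * n := by
  have hγ := h.γ_pos
  have hγ1 := h.γ_le
  have hs : (0 : ℝ) < P.sampleSize n := by exact_mod_cast h.s_pos
  have hn : (0 : ℝ) < n := by exact_mod_cast h.n_pos
  simp only [IsTypical, Pi.one_apply, Finset.sum_const, nsmul_eq_mul, mul_one] at hsize
  have hb : 0 ≤ (P.sampleSize n : ℝ) / n * (cell κ Finset.univ i).card := by positivity
  have h1 := (abs_le.mp hsize).1
  set b := (P.sampleSize n : ℝ) / n * (cell κ Finset.univ i).card with hbdef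
  have h2 : γ * (b + Real.log n ^ 2) ≤ 1 / 400 * (b + Real.log n ^ 2) := by gcongr
  have h3 : b ≤ 1.02 * (x * P.sampleSize n) := by linarith
  rw [hbdef, div_mul_eq_mul_div, div_le_iff₀ hn] at h3
  refine le_of_mul_le_mul_left ?_ hs
  linarith

theorem cell_subset {n : ℕ} (κ : Fin n → ℤ) (S : Finset (Fin n)) (i : ℤ) : cell κ S i ⊆ S :=
  Finset.filter_subset _ _

theorem mem_cell {n : ℕ} {κ : Fin n → ℤ} {S : Finset (Fin n)} {i : ℤ} {v : Fin n} :
    v ∈ cell κ S i ↔ v ∈ S ∧ κ v = i := Finset.mem_filter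

open scoped Classical in
theorem sum_cell_eq {n : ℕ} (κ : Fin n → ℤ) (J : Finset ℤ) (f : Fin n → ℝ) :
    ∑ i ∈ J, ∑ v ∈ cell κ Finset.univ i, f v = ∑ v with κ v ∈ J, f v := by
  rw [← Finset.sum_fiberwise_of_maps_to (s := Finset.univ.filter fun v => κ v ∈ J) (t := J)
    (g := κ) (by simp)]
  refine Finset.sum_congr rfl fun i hi => Finset.sum_congr ?_ fun _ _ => rfl
  ext v
  simp only [mem_cell, Finset.mem_univ, true_and, Finset.mem_filter]
  exact ⟨fun hv => ⟨hv ▸ hi, hv⟩, fun hv => hv.2⟩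

theorem exists_countedVertices_eq_candidate {P : Params} {n : ℕ} {κ : Fin n → ℤ} {S : Finset (Fin n)}
    {J : Finset ℤ} (hJ : (J : Set ℤ) = bigLabels P κ S) :
    ∃ b, countedVertices P κ S = candidate P κ J b := by
  classical
  by_cases hm : MergedCellSmall P κ S
  · exact ⟨true, by simp [countedVertices, candidate, hm, hJ]⟩
  · exact ⟨false, by simp [countedVertices, candidate, hm, hJ]⟩

section Deterministic

variable {P : Params} {n : ℕ} {γ N : ℝ} (h : Regime P n γ N) {G : SimpleGraph (Fin n)}
  {c : Coins n} (hg : Good P G γ N c)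
include h hg

/-- The size threshold is positive, so a big label occurs at some sampled vertex and lies in the
window of `label_le`. -/
theorem exists_bigLabels_eq :
    ∃ J : Finset ℤ, J ⊆ Finset.Ioc ⌊P.cutoff n⌋ (⌊P.cutoff n⌋ + P.t n) ∧
      (J : Set ℤ) = bigLabels P (labels P (noisyDegree G c.1.2)) c.1.1 := by
  have hsub : bigLabels P (labels P (noisyDegree G c.1.2)) c.1.1 ⊆
      (Finset.Ioc ⌊P.cutoff n⌋ (⌊P.cutoff n⌋ + P.t n) : Finset ℤ) := by
    rintro i ⟨hi, hcard⟩
    rw [Finset.coe_Ioc, Set.mem_Ioc]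
    refine ⟨hi, ?_⟩
    have hpos : (0 : ℝ) < (cell (labels P (noisyDegree G c.1.2)) c.1.1 i).card := by
      refine lt_of_lt_of_le ?_ hcard
      rw [hg.sample.card_eq]
      linarith [h.lam_le, h.one_le_lam]
    obtain ⟨v, hv⟩ := Finset.card_pos.mp (Nat.cast_pos.mp hpos)
    rw [← (mem_cell.mp hv).2]
    exact label_le h hg.noise v
  refine ⟨((Finset.finite_toSet _).subset hsub).toFinset, ?_, ?_⟩
  · simpa [Set.Finite.toFinset_subset] using hsub
  · simp

/-- The contribution of the big buckets is close to the sum of the degrees in big buckets and of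
the number of edges from big buckets to counted vertices. -/
theorem bigSum_bounds {J : Finset ℤ}
    (hJR : J ⊆ Finset.Ioc ⌊P.cutoff n⌋ (⌊P.cutoff n⌋ + P.t n))
    (hJ : (J : Set ℤ) = bigLabels P (labels P (noisyDegree G c.1.2)) c.1.1) :
    (1 - 5 * γ) * (1 - γ) * ((P.sampleSize n : ℝ) / n *
        ∑ v with labels P (noisyDegree G c.1.2) v ∈ J,
          (deg G v + degIn G (countedVertices P (labels P (noisyDegree G c.1.2)) c.1.1) v)) ≤
      bigSum P (noisyDegree G c.1.2) c.1.1
        (alphaEstimate P (noisyDegree G c.1.2) c.1.1 c.2.1.1 c.2.1.2) ∧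
    bigSum P (noisyDegree G c.1.2) c.1.1
        (alphaEstimate P (noisyDegree G c.1.2) c.1.1 c.2.1.1 c.2.1.2) ≤
      (1 + 5 * γ) * ((1 + P.β) * (1 + γ)) * ((P.sampleSize n : ℝ) / n *
        ∑ v with labels P (noisyDegree G c.1.2) v ∈ J,
          (deg G v + degIn G (countedVertices P (labels P (noisyDegree G c.1.2)) c.1.1) v)) := by
  classical
  set d := noisyDegree G c.1.2 with hd
  set κ := labels P d with hκ
  set S := c.1.1 with hS
  set C := countedVertices P κ S with hC
  have hβ := h.β_pos
  have hsum : bigSum P d S (alphaEstimate P d S c.2.1.1 c.2.1.2) =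
      ∑ i ∈ J, ((cell κ S i).card + ∑ v ∈ cell κ S i, hit C (c.2.1.1 v) + c.2.1.2 i) *
        (1 + P.β) ^ i := by
    rw [bigSum, bigIndices_eq hβ, ← hκ, ← hJ, finsum_mem_coe_finset]
    refine Finset.sum_congr rfl fun i hi => ?_
    have hi' : i ∈ bigLabels P κ S := hJ ▸ Finset.mem_coe.mpr hi
    have hpos : ((cell κ S i).card : ℝ) ≠ 0 := by
      refine ne_of_gt (lt_of_lt_of_le ?_ hi'.2)
      rw [hg.sample.card_eq]
      linarith [h.lam_le, h.one_le_lam]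
    rw [alphaEstimate, sampleBucket_eq_cell hβ hi'.1, ← hκ]
    simp only [edgeIndicator_eq_hit hβ h.cutoff_le_ceilCutoff, ← hκ, ← hC]
    field_simp
    ring
  -- The counted set depends on the sample, but it is one of the candidates for which `SampleGood`
  -- was required in advance.
  obtain ⟨b, hb⟩ := exists_countedVertices_eq_candidate hJ
  have hterm : ∀ i ∈ J, _ := fun i hi => by
    have hi' : i ∈ bigLabels P κ S := hJ ▸ Finset.mem_coe.mpr hi
    have hiR := hJR hi
    have hiR' : i ∈ Finset.Icc ⌊P.cutoff n⌋ (⌊P.cutoff n⌋ + P.t n) :=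
      Finset.Ioc_subset_Icc_self hiR
    refine bucket_term_bounds h (G := G) (κ := κ) (S := S) (C := C) (i := i)
      (u := (1 + P.β) ^ i) (x := ∑ v ∈ cell κ S i, hit C (c.2.1.1 v)) (z := c.2.1.2 i)
      (by positivity) (fun v hv => zpow_label_bounds h hg.noise hi'.1 (mem_cell.mp hv).2)
      ?_ (hg.sample.size i hiR') ?_ (hg.neighbors.big i hiR hi') (hg.noise_big i hiR)
    · refine le_trans ?_ hi'.2
      rw [hg.sample.card_eq]
      exact h.lam_le
    · rw [hC, hb]
      exact hg.sample.frac i hiR' J (Finset.mem_powerset.mpr hJR) b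
  rw [hsum, ← sum_cell_eq, Finset.mul_sum, Finset.mul_sum, Finset.mul_sum]
  exact ⟨Finset.sum_le_sum fun i hi => (hterm i hi).1, Finset.sum_le_sum fun i hi => (hterm i hi).2⟩

/-- There are few vertices in small buckets other than the merged one. -/
theorem card_small_le {J : Finset ℤ}
    (hJ : (J : Set ℤ) = bigLabels P (labels P (noisyDegree G c.1.2)) c.1.1) :
    ((Finset.univ.filter fun v => labels P (noisyDegree G c.1.2) v ∈
      Finset.Ioc ⌊P.cutoff n⌋ (⌊P.cutoff n⌋ + P.t n) \ J).card : ℝ) ≤ 0.612 * √(P.ρ * n) := by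
  classical
  set κ := labels P (noisyDegree G c.1.2) with hκ
  set R := Finset.Ioc ⌊P.cutoff n⌋ (⌊P.cutoff n⌋ + P.t n) with hR
  have hn : (0 : ℝ) < n := by exact_mod_cast h.n_pos
  have h1 := sum_cell_eq κ (R \ J) fun _ => (1 : ℝ)
  simp only [Finset.sum_const, nsmul_eq_mul, mul_one] at h1
  rw [← h1]
  have h2 : ∀ i ∈ R \ J, ((cell κ Finset.univ i).card : ℝ) ≤ 1.02 * (1.2 * P.T n) * n := by
    intro i hi
    rw [Finset.mem_sdiff] at hi
    have hiR : i ∈ Finset.Icc ⌊P.cutoff n⌋ (⌊P.cutoff n⌋ + P.t n) :=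
      Finset.Ioc_subset_Icc_self hi.1
    refine card_cell_le h (hg.sample.size i hiR) ?_ ?_
    · have hi' : i ∉ bigLabels P κ c.1.1 := fun hi' => hi.2 (by
        rwa [← Finset.mem_coe, hJ])
      have : ¬ (1.2 * P.T n * c.1.1.card ≤ (cell κ c.1.1 i).card) := fun hh =>
        hi' ⟨(Finset.mem_Ioc.mp hi.1).1, hh⟩
      rw [hg.sample.card_eq] at this
      exact (not_le.mp this).le
    · linarith [h.lam_le, h.one_le_lam]
  refine (Finset.sum_le_card_nsmul _ _ _ h2).trans ?_
  have h3 : ((R \ J).card : ℝ) ≤ P.t n := by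
    have : (R \ J).card ≤ R.card := Finset.card_le_card Finset.sdiff_subset
    have hRc : R.card = P.t n := by simp [hR]
    rw [hRc] at this
    exact_mod_cast this
  have hT := h.T_pos
  rw [nsmul_eq_mul]
  -- The constant is 1.02 · 1.2 / 2 = 0.612.
  calc ((R \ J).card : ℝ) * (1.02 * (1.2 * P.T n) * n) ≤ P.t n * (1.02 * (1.2 * P.T n) * n) := by
        gcongr
    _ = 1.224 * (P.t n * P.T n) * n := by ring
    _ ≤ 1.224 * (1 / 2 * √(P.ρ / n)) * n := by
        exact mul_le_mul_of_nonneg_right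
          (mul_le_mul_of_nonneg_left h.T_le (by norm_num)) hn.le
    _ = 0.612 * (√(P.ρ / n) * n) := by ring
    _ = 0.612 * √(P.ρ * n) := by
        congr 1
        rw [Real.sqrt_div h.ρ_pos.le, Real.sqrt_mul h.ρ_pos.le, div_mul_eq_mul_div,
          div_eq_iff (by positivity), mul_assoc, Real.mul_self_sqrt hn.le]

/-- Clamped degrees equal degrees here. Undoing the scaling by the clamp turns the additive sampling
error into γ · clamp · log² n; two of these cost at most γs, the Laplace noise γs and the neighbor
queries γs, which makes 3γs. -/
theorem merged_bounds {J : Finset ℤ}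
    (hJR : J ⊆ Finset.Ioc ⌊P.cutoff n⌋ (⌊P.cutoff n⌋ + P.t n))
    (hJ : (J : Set ℤ) = bigLabels P (labels P (noisyDegree G c.1.2)) c.1.1) :
    |c.2.2.2 + ∑ v ∈ mergedSample P (noisyDegree G c.1.2) c.1.1,
        (1 + mergedEdgeIndicator P (noisyDegree G c.1.2) c.1.1 (c.2.2.1 v)) * clampedDeg P G v -
      (P.sampleSize n : ℝ) / n * ∑ v ∈ cell (labels P (noisyDegree G c.1.2)) Finset.univ
        ⌊P.cutoff n⌋, (deg G v + degIn G (smallUnmergedVertices P (labels P (noisyDegree G c.1.2))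
          (bigLabels P (labels P (noisyDegree G c.1.2)) c.1.1)) v)| ≤
    γ * ((P.sampleSize n : ℝ) / n * ∑ v ∈ cell (labels P (noisyDegree G c.1.2)) Finset.univ
        ⌊P.cutoff n⌋, (deg G v + degIn G (smallUnmergedVertices P (labels P (noisyDegree G c.1.2))
          (bigLabels P (labels P (noisyDegree G c.1.2)) c.1.1)) v)) + 3 * γ * P.sampleSize n := by
  classical
  have hβ := h.β_pos
  have hγ := h.γ_pos
  have hD := h.clamp_pos
  rw [mergedSample_eq_cell hβ]
  simp only [mergedEdgeIndicator_eq_hit hβ h.cutoff_le_ceilCutoff]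
  set d := noisyDegree G c.1.2 with hd
  set κ := labels P d with hκ
  set S := c.1.1 with hS
  set C := smallUnmergedVertices P κ (bigLabels P κ S) with hC
  set σ := (P.sampleSize n : ℝ) / n
  set i₀ := ⌊P.cutoff n⌋ with hi₀
  have hC' : C = candidate P κ J false := by simp [hC, candidate, hJ]
  have hiR : i₀ ∈ Finset.Icc i₀ (i₀ + P.t n) := by simp
  have hclamp : ∀ v ∈ cell κ Finset.univ i₀, clampedDeg P G v = deg G v := fun v hv =>
    min_eq_left (deg_le_clamp_of_merged h hg.noise (mem_cell.mp hv).2)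
  have hscale : ∀ v, P.clamp n * scaledDeg P G v = clampedDeg P G v := fun v => by
    rw [scaledDeg]; field_simp
  have h1 := mul_le_mul_of_nonneg_left (hg.sample.deg i₀ hiR) hD.le
  have h2 := mul_le_mul_of_nonneg_left
    (hg.sample.deg_frac i₀ hiR J (Finset.mem_powerset.mpr hJR) false) hD.le
  have e : ∀ (A : Finset (Fin n)), P.clamp n * ∑ v ∈ A, scaledDeg P G v * fracIn G C v =
      ∑ v ∈ A, clampedDeg P G v * fracIn G C v := by
    intro A
    rw [Finset.mul_sum]
    simp only [← mul_assoc, hscale]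
  have e' : ∀ (A : Finset (Fin n)), P.clamp n * ∑ v ∈ A, scaledDeg P G v =
      ∑ v ∈ A, clampedDeg P G v := by
    intro A
    rw [Finset.mul_sum]
    simp only [hscale]
  rw [← abs_of_pos hD, ← abs_mul, abs_of_pos hD, mul_sub, mul_left_comm (P.clamp n) σ,
    mul_left_comm (P.clamp n) γ, mul_add (P.clamp n), mul_left_comm (P.clamp n) σ] at h1 h2
  rw [e', e'] at h1
  rw [← hC', e, e] at h2
  have f1 : ∑ v ∈ cell κ Finset.univ i₀, clampedDeg P G v = ∑ v ∈ cell κ Finset.univ i₀, deg G v :=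
    Finset.sum_congr rfl hclamp
  have f2 : ∑ v ∈ cell κ Finset.univ i₀, clampedDeg P G v * fracIn G C v =
      ∑ v ∈ cell κ Finset.univ i₀, degIn G C v :=
    Finset.sum_congr rfl fun v hv => by rw [hclamp v hv, deg_mul_fracIn]
  rw [f1] at h1
  rw [f2] at h2
  have h3 := hg.neighbors.merged
  have h4 := hg.noise_merged
  have h5 : ∑ v ∈ cell κ S i₀, (1 + hit C (c.2.2.1 v)) * clampedDeg P G v =
      ∑ v ∈ cell κ S i₀, clampedDeg P G v +
        ∑ v ∈ cell κ S i₀, clampedDeg P G v * hit C (c.2.2.1 v) := by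
    rw [← Finset.sum_add_distrib]
    exact Finset.sum_congr rfl fun v _ => by ring
  have h6 : γ * (2 * P.clamp n * Real.log n ^ 2) ≤ γ * P.sampleSize n :=
    mul_le_mul_of_nonneg_left h.clamp_lam_le hγ.le
  rw [h5, Finset.sum_add_distrib, mul_add]
  rw [abs_le] at h1 h2 h3 h4 ⊢
  constructor <;> linarith [h1.1, h1.2, h2.1, h2.2, h3.1, h3.2, h4.1, h4.2]

end Deterministic

/-- As A ≥ 1, additive errors that are multiples of ρ become multiples of ρA. The lower side loses
at most 0.3745ρ + 10γ relative to A, the upper side gains at most ρ/2 + 3γ. -/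
theorem output_bounds {P : Params} {n : ℕ} {γ N : ℝ} (h : Regime P n γ N) {F A X : ℝ}
    (hA : 1 ≤ A) (hF0 : 0 ≤ F) (hF : F ≤ n * A)
    (hF' : n * A ≤ F + (0.612 * √(P.ρ * n)) ^ 2 + γ * n)
    (hX : (1 - 5 * γ) * (1 - γ) * ((P.sampleSize n : ℝ) / n * F) - 3 * γ * P.sampleSize n ≤ X)
    (hX' : X ≤ (1 + 5 * γ) * ((1 + P.β) * (1 + γ)) * ((P.sampleSize n : ℝ) / n * F) +
      3 * γ * P.sampleSize n) :
    (1 - P.ρ) * A ≤ 1 / (P.sampleSize n : ℝ) * X ∧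
      1 / (P.sampleSize n : ℝ) * X ≤ (1 + P.ρ) * A := by
  have hs : (0 : ℝ) < P.sampleSize n := by exact_mod_cast h.s_pos
  have hn : (0 : ℝ) < n := by exact_mod_cast h.n_pos
  have hγ := h.γ_pos
  have hγ1 := h.γ_le
  have hρ := h.ρ_pos
  have hρ1 := h.ρ_lt
  have hγρ := h.γ_eq
  have hβ := h.β_pos
  have hβ1 := h.β_le
  set s := (P.sampleSize n : ℝ)
  set f : ℝ := F / n with hf
  have hf0 : 0 ≤ f := by positivity
  have hfA : f ≤ A := by rw [hf, div_le_iff₀ hn]; linarith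
  have hsq : (0.612 * √(P.ρ * n)) ^ 2 = 0.374544 * P.ρ * n := by
    rw [mul_pow, Real.sq_sqrt (by positivity)]
    ring
  have hAf : A ≤ f + 0.374544 * P.ρ + γ := by
    refine le_of_mul_le_mul_left ?_ hn
    rw [hsq] at hF'
    have : n * f = F := by rw [hf]; field_simp
    linarith
  have e : s / n * F = s * f := by rw [hf]; field_simp
  rw [e] at hX hX'
  have hK : (1 + 5 * γ) * ((1 + P.β) * (1 + γ)) ≤ 1 + P.ρ / 2 := by
    have h1 : (1 + 5 * γ) * (1 + γ) ≤ 1 + 7 * γ := by nlinarith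
    have h2 : (1 + P.β) * (1 + 7 * γ) ≤ (1 + P.ρ / 8) * (1 + 7 * γ) := by gcongr
    calc (1 + 5 * γ) * ((1 + P.β) * (1 + γ)) = (1 + P.β) * ((1 + 5 * γ) * (1 + γ)) := by ring
      _ ≤ (1 + P.β) * (1 + 7 * γ) := by gcongr
      _ ≤ _ := h2
      _ ≤ _ := by rw [hγρ]; nlinarith
  have hK' : 1 - 6 * γ ≤ (1 - 5 * γ) * (1 - γ) := by nlinarith
  rw [one_div_mul_eq_div, le_div_iff₀ hs, div_le_iff₀ hs]
  constructor
  · refine le_trans ?_ hX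
    have h1 : (1 - 6 * γ) * (s * f) ≤ (1 - 5 * γ) * (1 - γ) * (s * f) := by gcongr
    have h2 : (1 - P.ρ) * A ≤ (1 - 6 * γ) * f - 3 * γ := by
      have h3 : γ * f ≤ γ * A := by gcongr
      have h4 : P.ρ ≤ P.ρ * A := by nlinarith
      rw [hγρ] at *
      nlinarith
    have h3 := mul_le_mul_of_nonneg_right h2 hs.le
    linarith
  · refine hX'.trans ?_
    have h1 : (1 + 5 * γ) * ((1 + P.β) * (1 + γ)) * (s * f) ≤ (1 + P.ρ / 2) * (s * A) := by
      gcongr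
    have h4 : P.ρ ≤ P.ρ * A := by nlinarith
    have h5 : 3 * γ * s ≤ 3 * (P.ρ * A / 100) * s := by
      gcongr
      rw [hγρ]
      linarith
    have h6 : 0 ≤ P.ρ * A * s := by positivity
    linarith

theorem mainAlgorithm_bounds {P : Params} {n : ℕ} {γ N : ℝ} (h : Regime P n γ N)
    {G : SimpleGraph (Fin n)} {c : Coins n} (hg : Good P G γ N c) (hd : 1 ≤ avgDegree G) :
    (1 - P.ρ) * avgDegree G ≤ mainAlgorithm P G c ∧
      mainAlgorithm P G c ≤ (1 + P.ρ) * avgDegree G := by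
  classical
  have hβ := h.β_pos
  have hγ := h.γ_pos
  have hγ1 := h.γ_le
  have hn : (0 : ℝ) < n := by exact_mod_cast h.n_pos
  have hs : (0 : ℝ) < P.sampleSize n := by exact_mod_cast h.s_pos
  have hD := h.clamp_pos
  obtain ⟨J, hJR, hJ⟩ := exists_bigLabels_eq h hg
  have hbig := bigSum_bounds h hg hJR hJ
  have hsmall := card_small_le h hg hJ
  have hmerged := merged_bounds h hg hJR hJ
  have hcard := hg.sample.card_eq
  have hle := label_le h hg.noise (G := G)
  have hsumdeg := sum_deg_eq G h.n_pos
  simp only [mainAlgorithm, noisyAvgDegree, mergedSmall_iff hβ]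
  have hclampQ : ∀ v, (labels P (noisyDegree G c.1.2) v : ℝ) ≤ P.ceilCutoff n →
      deg G v ≤ P.clamp n := fun v hv => deg_le_clamp_of_label h hg.noise hv
  have hge : ∀ v, ⌊P.cutoff n⌋ ≤ labels P (noisyDegree G c.1.2) v := fun v => cutoff_le_label hβ _
  have hsize0 := hg.sample.size ⌊P.cutoff n⌋ (by simp)
  set d := noisyDegree G c.1.2 with hd'
  set κ := labels P d with hκ
  set S := c.1.1 with hS
  set i₀ := ⌊P.cutoff n⌋ with hi₀
  set U := Finset.univ.filter fun v => κ v ∈ J with hU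
  set C' := Finset.univ.filter fun v => κ v ∈ Finset.Ioc i₀ (i₀ + P.t n) \ J with hC'
  have hFnn : ∀ (A C : Finset (Fin n)), 0 ≤ ∑ v ∈ A, (deg G v + degIn G C v) := fun A C =>
    Finset.sum_nonneg fun v _ => add_nonneg (deg_nonneg G v) (degIn_nonneg G C v)
  have hmemJ : ∀ i, i ∈ bigLabels P κ S ↔ i ∈ J := fun i => by rw [← hJ, Finset.mem_coe]
  have hi₀J : i₀ ∉ J := fun hh => (Finset.mem_Ioc.mp (hJR hh)).1.ne rfl
  -- If S₁ is small, U consists of the big buckets, C of all other vertices, and Q is the merged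
  -- bucket. Otherwise the merged bucket joins U, and Q collects the small buckets between the two
  -- cutoffs, which neither U nor C covers.
  by_cases hm : MergedCellSmall P κ S
  · rw [if_pos hm, hcard]
    have hC : countedVertices P κ S = smallVertices κ (bigLabels P κ S) := if_pos hm
    rw [hC] at hbig
    set C := smallVertices κ (bigLabels P κ S) with hCdef
    have hmemC : ∀ v, v ∈ C ↔ κ v ∉ J := fun v => by
      simp [hCdef, smallVertices, hmemJ]
    have hQ : ∑ v ∈ cell κ Finset.univ i₀, deg G v ≤ γ / 2 * n := by
      have h1 : ∑ v ∈ cell κ Finset.univ i₀, deg G v ≤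
          (cell κ Finset.univ i₀).card • P.clamp n :=
        Finset.sum_le_card_nsmul _ _ _ fun v hv =>
          deg_le_clamp_of_merged h hg.noise (mem_cell.mp hv).2
      have h2 : ((cell κ Finset.univ i₀).card : ℝ) ≤
          1.02 * (1.2 * P.T n * √(P.sampleSize n : ℝ)) * n := by
        refine card_cell_le h hsize0 ?_ ?_
        · have := hm.le
          rwa [hcard] at this
        · have h3 : 1 ≤ √(P.sampleSize n : ℝ) := by
            rw [Real.one_le_sqrt]
            exact_mod_cast h.s_pos
          have h4 := h.T_pos
          have h5 : 1.2 * P.T n * 1 * P.sampleSize n ≤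
            1.2 * P.T n * √(P.sampleSize n : ℝ) * P.sampleSize n := by gcongr
          linarith [h.lam_le, h.one_le_lam]
      rw [nsmul_eq_mul] at h1
      have h3 := mul_le_mul_of_nonneg_right h2 hD.le
      have h4 := mul_le_mul_of_nonneg_right h.T_sqrt_le hn.le
      have h5 : 0 < γ * n := by positivity
      linarith
    refine output_bounds h hd (hFnn U C) ?_ ?_ ?_ ?_
    · rw [← hsumdeg]
      refine sum_deg_add_degIn_le G (Finset.disjoint_left.mpr fun v hv hv' => ?_)
      exact (hmemC v).mp hv' (Finset.mem_filter.mp hv).2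
    · rw [← hsumdeg]
      refine (sum_deg_le_sum_deg_add_degIn G (U := U) (C := C) (C' := C')
        (Q := cell κ Finset.univ i₀) ?_ ?_).trans ?_
      · intro v hv
        rw [hmemC]
        exact (Finset.mem_sdiff.mp (Finset.mem_filter.mp hv).2).2
      · intro v
        simp only [hU, hC', Finset.mem_filter, Finset.mem_univ, true_and, mem_cell,
          Finset.mem_sdiff, Finset.mem_Ioc]
        by_cases hvJ : κ v ∈ J
        · exact Or.inl hvJ
        · rcases (hge v).eq_or_lt with hv | hv
          · exact Or.inr (Or.inr hv.symm)
          · exact Or.inr (Or.inl ⟨⟨hv, hle v⟩, hvJ⟩)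
      · have : (C'.card : ℝ) ^ 2 ≤ (0.612 * √(P.ρ * n)) ^ 2 := by gcongr
        linarith
    · have : 0 ≤ 3 * γ * (P.sampleSize n : ℝ) := by positivity
      linarith [hbig.1]
    · have : 0 ≤ 3 * γ * (P.sampleSize n : ℝ) := by positivity
      linarith [hbig.2]
  · rw [if_neg hm, hcard]
    have hC : countedVertices P κ S = smallUnmergedVertices P κ (bigLabels P κ S) := if_neg hm
    rw [hC] at hbig
    set C := smallUnmergedVertices P κ (bigLabels P κ S) with hCdef
    have hmemC : ∀ v, v ∈ C ↔ κ v ∉ J ∧ P.ceilCutoff n < κ v := fun v => by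
      simp [hCdef, smallUnmergedVertices, hmemJ]
    have hdisj : Disjoint U (cell κ Finset.univ i₀) := by
      refine Finset.disjoint_left.mpr fun v hv hv' => hi₀J ?_
      rw [← (mem_cell.mp hv').2]
      exact (Finset.mem_filter.mp hv).2
    set Q := C'.filter fun v => (κ v : ℝ) ≤ P.ceilCutoff n with hQdef
    have hlt : ∀ v, P.ceilCutoff n < κ v → i₀ < κ v := fun v hv =>
      Int.floor_lt.mpr (h.cutoff_le_ceilCutoff.trans_lt hv)
    have hCC' : C ⊆ C' := by
      intro v hv
      rw [hmemC] at hv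
      simp only [hC', Finset.mem_filter, Finset.mem_univ, true_and, Finset.mem_sdiff,
        Finset.mem_Ioc]
      exact ⟨⟨hlt v hv.2, hle v⟩, hv.1⟩
    have hQ : ∑ v ∈ Q, deg G v ≤ γ / 2 * n := by
      have h1 : ∑ v ∈ Q, deg G v ≤ Q.card • P.clamp n :=
        Finset.sum_le_card_nsmul _ _ _ fun v hv => hclampQ v (Finset.mem_filter.mp hv).2
      have h2 : (Q.card : ℝ) ≤ C'.card :=
        Nat.cast_le.mpr (Finset.card_le_card (Finset.filter_subset _ _))
      have h3 : √(P.ρ * n) ≤ √(n : ℝ) := by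
        refine Real.sqrt_le_sqrt ?_
        nlinarith [h.ρ_lt]
      have h4 : (Q.card : ℝ) ≤ √(n : ℝ) := by
        have := Real.sqrt_nonneg (P.ρ * n)
        linarith
      rw [nsmul_eq_mul] at h1
      have h5 := mul_le_mul_of_nonneg_right h4 hD.le
      linarith [h.sqrt_clamp_le]
    have hsplit : ∑ v ∈ U ∪ cell κ Finset.univ i₀, (deg G v + degIn G C v) =
        ∑ v ∈ U, (deg G v + degIn G C v) +
          ∑ v ∈ cell κ Finset.univ i₀, (deg G v + degIn G C v) := Finset.sum_union hdisj
    have hMnn : 0 ≤ (P.sampleSize n : ℝ) / n *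
        ∑ v ∈ cell κ Finset.univ i₀, (deg G v + degIn G C v) :=
      mul_nonneg (by positivity) (hFnn _ _)
    -- The merged part is more accurate; its factors are weakened to those of the big buckets so
    -- that both parts add up to one multiple of F.
    have hK' : (1 - 5 * γ) * (1 - γ) ≤ 1 - γ := by nlinarith
    have hK : 1 + γ ≤ (1 + 5 * γ) * ((1 + P.β) * (1 + γ)) := by
      have : 0 < P.β * γ := by positivity
      have : 0 < P.β * γ * γ := by positivity
      nlinarith
    have hK'm := mul_le_mul_of_nonneg_right hK' hMnn
    have hKm := mul_le_mul_of_nonneg_right hK hMnn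
    rw [abs_le] at hmerged
    refine output_bounds h hd (hFnn (U ∪ cell κ Finset.univ i₀) C) ?_ ?_ ?_ ?_
    · rw [← hsumdeg]
      refine sum_deg_add_degIn_le G (Finset.disjoint_left.mpr fun v hv hv' => ?_)
      rw [hmemC] at hv'
      rcases Finset.mem_union.mp hv with hv | hv
      · exact hv'.1 (Finset.mem_filter.mp hv).2
      · exact (hlt v hv'.2).ne' (mem_cell.mp hv).2
    · rw [← hsumdeg]
      refine (sum_deg_le_sum_deg_add_degIn G (U := U ∪ cell κ Finset.univ i₀) (C := C) (C' := C)
        (Q := Q) subset_rfl ?_).trans ?_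
      · intro v
        rw [hmemC]
        simp only [hU, hQdef, hC', Finset.mem_union, Finset.mem_filter, Finset.mem_univ, true_and,
          mem_cell, Finset.mem_sdiff, Finset.mem_Ioc]
        by_cases hvJ : κ v ∈ J
        · exact Or.inl (Or.inl hvJ)
        · rcases (hge v).eq_or_lt with hv | hv
          · exact Or.inl (Or.inr hv.symm)
          · rcases lt_or_ge (P.ceilCutoff n) (κ v) with hv' | hv'
            · exact Or.inr (Or.inl ⟨hvJ, hv'⟩)
            · exact Or.inr (Or.inr ⟨⟨⟨hv, hle v⟩, hvJ⟩, hv'⟩)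
      · have h1 : (C.card : ℝ) ≤ C'.card := Nat.cast_le.mpr (Finset.card_le_card hCC')
        have : (C.card : ℝ) ^ 2 ≤ (0.612 * √(P.ρ * n)) ^ 2 := by
          gcongr
          exact h1.trans hsmall
        linarith
    · rw [hsplit, mul_add, mul_add]
      linarith [hbig.1, hmerged.1]
    · rw [hsplit, mul_add, mul_add]
      linarith [hbig.2, hmerged.2]

/-! ### Fubini and union bounds -/

theorem prod_le_of_forall_section_le {α β : Type*} [MeasurableSpace α] [MeasurableSpace β]
    (μ : Measure α) (ν : Measure β) [IsProbabilityMeasure μ] [SFinite ν] {A : Set (α × β)}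
    (hA : MeasurableSet A) {δ : ENNReal} (h : ∀ x, ν (Prod.mk x ⁻¹' A) ≤ δ) :
    μ.prod ν A ≤ δ := by
  rw [Measure.prod_apply hA]
  refine (lintegral_mono h).trans ?_
  simp

theorem prod_le_of_forall_section_symm_le {α β : Type*} [MeasurableSpace α] [MeasurableSpace β]
    (μ : Measure α) (ν : Measure β) [SFinite μ] [IsProbabilityMeasure ν] {A : Set (α × β)}
    (hA : MeasurableSet A) {δ : ENNReal} (h : ∀ y, μ ((fun x => (x, y)) ⁻¹' A) ≤ δ) :
    μ.prod ν A ≤ δ := by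
  rw [Measure.prod_apply_symm hA]
  refine (lintegral_mono h).trans ?_
  simp

theorem measure_exists_mem_le {ι Ω : Type*} [MeasurableSpace Ω] (μ : Measure Ω) (I : Finset ι)
    (p : ι → Ω → Prop) {δ : ℝ} (h : ∀ i ∈ I, μ {ω | p i ω} ≤ ENNReal.ofReal δ) :
    μ {ω | ∃ i ∈ I, p i ω} ≤ ENNReal.ofReal (I.card * δ) := by
  have e : {ω | ∃ i ∈ I, p i ω} = ⋃ i ∈ I, {ω | p i ω} := by
    ext ω
    simp
  rw [e]
  refine (measure_biUnion_finset_le I _).trans ((Finset.sum_le_sum h).trans ?_)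
  rw [Finset.sum_const, nsmul_eq_mul, ENNReal.ofReal_mul (Nat.cast_nonneg _),
    ENNReal.ofReal_natCast]

theorem measure_or_le {Ω : Type*} [MeasurableSpace Ω] (μ : Measure Ω) (p q : Ω → Prop) {δ η : ℝ}
    (hδ : 0 ≤ δ) (hη : 0 ≤ η) (hp : μ {ω | p ω} ≤ ENNReal.ofReal δ)
    (hq : μ {ω | q ω} ≤ ENNReal.ofReal η) : μ {ω | p ω ∨ q ω} ≤ ENNReal.ofReal (δ + η) := by
  rw [ENNReal.ofReal_add hδ hη]
  exact (measure_union_le _ _).trans (add_le_add hp hq)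

theorem card_sample_ne (P : Params) (n : ℕ) :
    (randomSample (P.sampleSize_le n)).toMeasure
      {S : Finset (Fin n) | S.card ≠ P.sampleSize n} = 0 := by
  rw [PMF.toMeasure_apply_eq_zero_iff _ MeasurableSet.of_discrete, randomSample,
    PMF.support_uniformOfFinset, Set.disjoint_left]
  exact fun S hS hS' => hS' (Finset.mem_powersetCard.mp hS).2

/-! ### Failure probability of the sample -/

section Sampling

variable {P : Params} {n : ℕ} {γ N : ℝ} (h : Regime P n γ N) (G : SimpleGraph (Fin n))
  (κ : Fin n → ℤ)
include h

theorem not_isTypical_le (i : ℤ) (w : Fin n → ℝ) (hw : ∀ v, 0 ≤ w v) (hw1 : ∀ v, w v ≤ 1) :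
    (randomSample (P.sampleSize_le n)).toMeasure {S | ¬ IsTypical P γ κ S i w} ≤
      ENNReal.ofReal (2 * Real.exp (-(γ ^ 2 * Real.log n ^ 2))) := by
  classical
  refine le_trans (measure_mono fun S hS => ?_) (randomSample_deviation_le (P.sampleSize_le n)
    (fun v => if κ v = i then w v else 0) (fun v => ?_) (fun v => ?_)
    (lam := Real.log n ^ 2) h.γ_pos.le (by linarith [h.γ_le]))
  · simp only [← Finset.sum_filter]
    exact (not_le.mp hS).le
  · split_ifs
    exacts [hw v, le_rfl]
  · split_ifs
    exacts [hw1 v, zero_le_one]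

theorem scaledDeg_nonneg (v : Fin n) : 0 ≤ scaledDeg P G v :=
  div_nonneg (le_min (deg_nonneg G v) h.clamp_pos.le) h.clamp_pos.le

theorem scaledDeg_le_one (v : Fin n) : scaledDeg P G v ≤ 1 :=
  div_le_one_of_le₀ (min_le_right _ _) h.clamp_pos.le

/-- Union bound for fixed labels: each of the t + 1 cells carries the constant weight, the scaled
degree, and two weights for each of the 2 · 2^t candidate sets. -/
theorem not_sampleGood_le :
    (randomSample (P.sampleSize_le n)).toMeasure {S | ¬ SampleGood P G γ κ S} ≤
      ENNReal.ofReal ((P.t n + 1) * (2 + 2 ^ P.t n * 4) *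
        (2 * Real.exp (-(γ ^ 2 * Real.log n ^ 2)))) := by
  set μ := (randomSample (P.sampleSize_le n)).toMeasure
  set e := 2 * Real.exp (-(γ ^ 2 * Real.log n ^ 2)) with he
  have he0 : 0 ≤ e := by positivity
  set R' := Finset.Icc ⌊P.cutoff n⌋ (⌊P.cutoff n⌋ + P.t n) with hR'
  set PR := (Finset.Ioc ⌊P.cutoff n⌋ (⌊P.cutoff n⌋ + P.t n)).powerset with hPR
  have hcR' : (R'.card : ℝ) = P.t n + 1 := by
    have : R'.card = P.t n + 1 := by rw [hR', Int.card_Icc]; omega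
    rw [this]; push_cast; rfl
  have hcPR : (PR.card : ℝ) = 2 ^ P.t n := by
    have : PR.card = 2 ^ P.t n := by rw [hPR, Finset.card_powerset, Int.card_Ioc]; congr 1; omega
    rw [this]; push_cast; rfl
  have h1 := measure_exists_mem_le μ R' (fun i S => ¬ IsTypical P γ κ S i 1)
    fun i _ => not_isTypical_le h κ i 1 (fun _ => zero_le_one) (fun _ => le_rfl)
  have h2 := measure_exists_mem_le μ R' (fun i S => ¬ IsTypical P γ κ S i (scaledDeg P G))
    fun i _ => not_isTypical_le h κ i _ (scaledDeg_nonneg h G) (scaledDeg_le_one h G)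
  have h3 := measure_exists_mem_le μ (R' ×ˢ (PR ×ˢ (Finset.univ : Finset Bool)))
    (fun x S => ¬ IsTypical P γ κ S x.1 (fracIn G (candidate P κ x.2.1 x.2.2)))
    fun i _ => not_isTypical_le h κ _ _ (fracIn_nonneg G _) (fracIn_le_one G _)
  have h4 := measure_exists_mem_le μ (R' ×ˢ (PR ×ˢ (Finset.univ : Finset Bool)))
    (fun x S => ¬ IsTypical P γ κ S x.1
      fun v => scaledDeg P G v * fracIn G (candidate P κ x.2.1 x.2.2) v)
    fun i _ => not_isTypical_le h κ _ _
      (fun v => mul_nonneg (scaledDeg_nonneg h G v) (fracIn_nonneg G _ v))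
      (fun v => mul_le_one₀ (scaledDeg_le_one h G v) (fracIn_nonneg G _ v) (fracIn_le_one G _ v))
  have h0 : μ {S : Finset (Fin n) | S.card ≠ P.sampleSize n} ≤ ENNReal.ofReal 0 := by
    rw [card_sample_ne]
    simp
  rw [← he, hcR'] at h1 h2
  rw [← he, Finset.card_product, Finset.card_product, Nat.cast_mul, Nat.cast_mul, hcR', hcPR,
    Finset.card_univ, Fintype.card_bool] at h3 h4
  have hall := measure_or_le μ _ _ le_rfl (by positivity) h0 <|
    measure_or_le μ _ _ (by positivity) (by positivity) h1 <|
    measure_or_le μ _ _ (by positivity) (by positivity) h2 <|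
    measure_or_le μ _ _ (by positivity) (by positivity) h3 h4
  refine (measure_mono ?_).trans (hall.trans (ENNReal.ofReal_le_ofReal (le_of_eq ?_)))
  · intro S hS
    by_contra hcon
    simp only [Set.mem_ofPred_eq, not_or, not_exists, not_and, not_not] at hcon
    obtain ⟨c0, c1, c2, c3, c4⟩ := hcon
    exact hS ⟨c0, c1, c2,
      fun i hi J hJ b =>
        c3 (i, J, b) (Finset.mk_mem_product hi (Finset.mk_mem_product hJ (Finset.mem_univ b))),
      fun i hi J hJ b =>
        c4 (i, J, b) (Finset.mk_mem_product hi (Finset.mk_mem_product hJ (Finset.mem_univ b)))⟩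
  · push_cast
    ring

end Sampling

/-! ### Failure probability of the neighbor queries -/

section Neighbors

variable {P : Params} {n : ℕ} {γ N : ℝ} (h : Regime P n γ N) (G : SimpleGraph (Fin n))
  {κ : Fin n → ℤ} {S : Finset (Fin n)} (hS : S.card = P.sampleSize n)
include h hS

/-- With sample and labels fixed the counted set is fixed too. The restriction to big buckets
matters: Hoeffding's exponent 2γ²|cell| reaches γ² log² n because such a cell has at least 4 log² n
sampled vertices. -/
theorem not_neighbors_big_le :
    Measure.pi (fun v => (randomNeighbor G v).toMeasure)
      {r | ∃ i ∈ Finset.Ioc ⌊P.cutoff n⌋ (⌊P.cutoff n⌋ + P.t n), i ∈ bigLabels P κ S ∧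
        γ * (cell κ S i).card < |∑ v ∈ cell κ S i, hit (countedVertices P κ S) (r v) -
          ∑ v ∈ cell κ S i, fracIn G (countedVertices P κ S) v|} ≤
      ENNReal.ofReal (P.t n * (2 * Real.exp (-(γ ^ 2 * Real.log n ^ 2)))) := by
  have hγ := h.γ_pos
  have hcard : (Finset.Ioc ⌊P.cutoff n⌋ (⌊P.cutoff n⌋ + P.t n)).card = P.t n := by simp
  have key := measure_exists_mem_le (Measure.pi fun v => (randomNeighbor G v).toMeasure)
    (Finset.Ioc ⌊P.cutoff n⌋ (⌊P.cutoff n⌋ + P.t n))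
    (fun i r => i ∈ bigLabels P κ S ∧
        γ * (cell κ S i).card < |∑ v ∈ cell κ S i, hit (countedVertices P κ S) (r v) -
          ∑ v ∈ cell κ S i, fracIn G (countedVertices P κ S) v|)
    (δ := 2 * Real.exp (-(γ ^ 2 * Real.log n ^ 2))) fun i _ => ?_
  · rwa [hcard] at key
  by_cases hi : i ∈ bigLabels P κ S
  · have ha : 4 * Real.log n ^ 2 ≤ (cell κ S i).card := by
      refine h.lam_le.trans ?_
      rw [← hS]
      exact hi.2
    have h1 := h.one_le_lam
    refine (measure_mono fun r hr => ?_).trans ((pi_deviation_le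
      (fun v => (randomNeighbor G v).toMeasure) (fun _ => hit (countedVertices P κ S))
      (cell κ S i) (W := 1) (η := γ * (cell κ S i).card) (by positivity)
      fun v a => ⟨hit_nonneg _ _, hit_le_one _ _⟩).trans ?_)
    · simp only [integral_hit]
      exact hr.2.le
    · refine ENNReal.ofReal_le_ofReal ?_
      gcongr
      rw [one_pow, mul_one, le_div_iff₀ (by linarith)]
      have h2 : γ ^ 2 * Real.log n ^ 2 ≤ γ ^ 2 * (2 * (cell κ S i).card) := by
        gcongr
        linarith
      have h3 := mul_le_mul_of_nonneg_right h2 (Nat.cast_nonneg (cell κ S i).card)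
      linarith
  · simp [hi]

/-- The terms range up to the clamp and there are at most s of them, so the exponent is at least
2γ²s/clamp², which `hD` bounds below. -/
theorem not_neighbors_merged_le (hD : P.clamp n ^ 2 * Real.log n ^ 2 ≤ P.sampleSize n) :
    Measure.pi (fun v => (randomNeighbor G v).toMeasure)
      {r' | γ * P.sampleSize n < |∑ v ∈ cell κ S ⌊P.cutoff n⌋, clampedDeg P G v *
          hit (smallUnmergedVertices P κ (bigLabels P κ S)) (r' v) -
        ∑ v ∈ cell κ S ⌊P.cutoff n⌋, clampedDeg P G v *
          fracIn G (smallUnmergedVertices P κ (bigLabels P κ S)) v|} ≤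
      ENNReal.ofReal (2 * Real.exp (-(γ ^ 2 * Real.log n ^ 2))) := by
  have hγ := h.γ_pos
  have hc := h.clamp_pos
  have hs : (0 : ℝ) < P.sampleSize n := by exact_mod_cast h.s_pos
  set A := cell κ S ⌊P.cutoff n⌋
  rcases A.eq_empty_or_nonempty with hA | hA
  · have : ¬ γ * (P.sampleSize n : ℝ) < 0 := not_lt.mpr (by positivity)
    simp [hA, this]
  have hA0 : (0 : ℝ) < A.card := by exact_mod_cast Finset.card_pos.mpr hA
  have hAs : (A.card : ℝ) ≤ P.sampleSize n := by
    rw [← hS]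
    exact_mod_cast Finset.card_le_card (cell_subset κ S _)
  have hcd : ∀ v, 0 ≤ clampedDeg P G v := fun v => le_min (deg_nonneg G v) hc.le
  refine (measure_mono fun r hr => ?_).trans ((pi_deviation_le
    (fun v => (randomNeighbor G v).toMeasure)
    (fun v a => clampedDeg P G v * hit (smallUnmergedVertices P κ (bigLabels P κ S)) a)
    A (W := P.clamp n) (η := γ * P.sampleSize n) (by positivity) fun v a =>
      ⟨mul_nonneg (hcd v) (hit_nonneg _ _), ?_⟩).trans ?_)
  · simp only [integral_const_mul, integral_hit]
    rw [Set.mem_ofPred_eq] at hr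
    exact hr.le
  · calc clampedDeg P G v * hit (smallUnmergedVertices P κ (bigLabels P κ S)) a
        ≤ clampedDeg P G v * 1 := mul_le_mul_of_nonneg_left (hit_le_one _ _) (hcd v)
      _ ≤ P.clamp n := by rw [mul_one]; exact min_le_right _ _
  · refine ENNReal.ofReal_le_ofReal ?_
    gcongr
    rw [le_div_iff₀ (by positivity)]
    calc γ ^ 2 * Real.log n ^ 2 * (A.card * P.clamp n ^ 2)
        = γ ^ 2 * A.card * (P.clamp n ^ 2 * Real.log n ^ 2) := by ring
      _ ≤ γ ^ 2 * P.sampleSize n * P.sampleSize n := by gcongr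
      _ ≤ 2 * (γ * P.sampleSize n) ^ 2 := by
        have : 0 ≤ (γ * P.sampleSize n) ^ 2 := sq_nonneg _
        linarith

end Neighbors

/-! ### Failure probability of all coins together -/

section Law

variable {P : Params} {n : ℕ} {γ N : ℝ} (h : Regime P n γ N) (G : SimpleGraph (Fin n))

theorem measurable_labels :
    Measurable fun Y : Fin n → ℝ => labels P (noisyDegree G Y) := by
  refine measurable_pi_lambda _ fun v => measurable_label.comp ?_
  exact measurable_const.add (measurable_pi_apply v)

theorem isProbabilityMeasure_noise (hε : 0 < P.ε) : IsProbabilityMeasure (laplace (6 / P.ε)) :=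
  isProbabilityMeasure_laplace (by positivity)

include h in
theorem isProbabilityMeasure_merged_noise :
    IsProbabilityMeasure (laplace (36 * P.M n * (3 + P.β + 1 / P.β))) := by
  refine isProbabilityMeasure_laplace ?_
  have := h.one_le_M
  have := h.β_pos
  positivity

include h in
theorem isProbabilityMeasure_coinLaw (hε : 0 < P.ε) : IsProbabilityMeasure (coinLaw P G) := by
  have i1 := isProbabilityMeasure_noise hε
  have i2 := isProbabilityMeasure_merged_noise h
  unfold coinLaw
  infer_instance

/-- The constant 24 makes the exponent -Nε/12 equal to -2 log n, so a union over n vertices still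
leaves O(1/n). -/
theorem noise_tail_le (hε : 0 < P.ε) (hN : N * P.ε = 24 * Real.log n) {x : ℝ} (hx : N ≤ x) :
    laplace (6 / P.ε) {z | x < |z|} ≤ ENNReal.ofReal (2 * Real.exp (-(2 * Real.log n))) := by
  refine (measure_mono fun z (hz : x < |z|) => (hx.trans hz.le : N ≤ |z|)).trans
    ((laplace_tail (by positivity)).trans (le_of_eq ?_))
  congr 3
  have : -N / (2 * (6 / P.ε)) = -(N * P.ε) / 12 := by field_simp; ring
  rw [this, hN]
  ring

include h

theorem coinLaw_noise_le (hε : 0 < P.ε) (hN : N * P.ε = 24 * Real.log n) :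
    coinLaw P G {c | ∃ v ∈ (Finset.univ : Finset (Fin n)), N < |c.1.2 v|} ≤
      ENNReal.ofReal (n * (2 * Real.exp (-(2 * Real.log n)))) := by
  have i1 := isProbabilityMeasure_noise hε
  have i2 := isProbabilityMeasure_merged_noise h
  have key := measure_exists_mem_le (coinLaw P G) (Finset.univ : Finset (Fin n))
    (fun v (c : Coins n) => N < |c.1.2 v|) (δ := 2 * Real.exp (-(2 * Real.log n))) fun v _ => ?_
  · rwa [Finset.card_univ, Fintype.card_fin] at key
  have hmp : MeasurePreserving (fun c : Coins n => c.1.2 v) (coinLaw P G) (laplace (6 / P.ε)) :=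
    (measurePreserving_eval (fun _ : Fin n => laplace (6 / P.ε)) v).comp
      (measurePreserving_snd.comp measurePreserving_fst)
  have hms : MeasurableSet {z : ℝ | N < |z|} := measurableSet_lt measurable_const (by fun_prop)
  exact (hmp.measure_preimage hms.nullMeasurableSet).trans_le (noise_tail_le hε hN le_rfl)

theorem coinLaw_noise_big_le (hε : 0 < P.ε) (hN : N * P.ε = 24 * Real.log n)
    (hNlam : N ≤ γ * Real.log n ^ 2) :
    coinLaw P G {c | ∃ i ∈ Finset.Ioc ⌊P.cutoff n⌋ (⌊P.cutoff n⌋ + P.t n),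
        γ * Real.log n ^ 2 < |c.2.1.2 i|} ≤
      ENNReal.ofReal (P.t n * (2 * Real.exp (-(2 * Real.log n)))) := by
  have i1 := isProbabilityMeasure_noise hε
  have i2 := isProbabilityMeasure_merged_noise h
  have hcard : (Finset.Ioc ⌊P.cutoff n⌋ (⌊P.cutoff n⌋ + P.t n)).card = P.t n := by simp
  have key := measure_exists_mem_le (coinLaw P G)
    (Finset.Ioc ⌊P.cutoff n⌋ (⌊P.cutoff n⌋ + P.t n))
    (fun i (c : Coins n) => γ * Real.log n ^ 2 < |c.2.1.2 i|)
    (δ := 2 * Real.exp (-(2 * Real.log n))) fun i _ => ?_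
  · rwa [hcard] at key
  have hmp : MeasurePreserving (fun c : Coins n => c.2.1.2 i) (coinLaw P G)
      (laplace (6 / P.ε)) :=
    (measurePreserving_eval_infinitePi (fun _ : ℤ => laplace (6 / P.ε)) i).comp
      (measurePreserving_snd.comp (measurePreserving_fst.comp measurePreserving_snd))
  have hms : MeasurableSet {z : ℝ | γ * Real.log n ^ 2 < |z|} :=
    measurableSet_lt measurable_const (by fun_prop)
  exact (hmp.measure_preimage hms.nullMeasurableSet).trans_le (noise_tail_le hε hN hNlam)

theorem coinLaw_noise_merged_le (hε : 0 < P.ε)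
    (hD : P.clamp n ^ 2 * Real.log n ^ 2 ≤ P.sampleSize n) :
    coinLaw P G {c | γ * P.sampleSize n < |c.2.2.2|} ≤
      ENNReal.ofReal (2 * Real.exp (-(γ ^ 2 * Real.log n ^ 2))) := by
  have hγ := h.γ_pos
  have hc := h.clamp_pos
  have hlam := h.one_le_lam
  have i1 := isProbabilityMeasure_noise hε
  have i2 := isProbabilityMeasure_merged_noise h
  have hb : 36 * P.M n * (3 + P.β + 1 / P.β) = 6 * P.clamp n := by rw [Params.clamp]; ring
  have hmp : MeasurePreserving (fun c : Coins n => c.2.2.2) (coinLaw P G)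
      (laplace (36 * P.M n * (3 + P.β + 1 / P.β))) :=
    measurePreserving_snd.comp (measurePreserving_snd.comp measurePreserving_snd)
  have hms : MeasurableSet {z : ℝ | γ * P.sampleSize n < |z|} :=
    measurableSet_lt measurable_const (by fun_prop)
  refine (hmp.measure_preimage hms.nullMeasurableSet).trans_le ?_
  rw [hb]
  refine (measure_mono fun z (hz : _ < |z|) => hz.le).trans
    ((laplace_tail (by positivity)).trans (ENNReal.ofReal_le_ofReal ?_))
  gcongr
  rw [neg_div, neg_le_neg_iff, le_div_iff₀ (by positivity)]
  have hc1 : 1 ≤ P.clamp n := by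
    have h1 := h.one_le_M
    have hβ := h.β_pos
    have : 0 ≤ 1 / P.β := by positivity
    rw [Params.clamp]
    nlinarith
  calc γ ^ 2 * Real.log n ^ 2 * (2 * (6 * P.clamp n))
      = γ * (12 * γ) * (P.clamp n * Real.log n ^ 2) := by ring
    _ ≤ γ * 1 * (P.clamp n ^ 2 * Real.log n ^ 2) := by
      gcongr
      · linarith [h.γ_le]
      · nlinarith
    _ ≤ γ * 1 * P.sampleSize n := by gcongr
    _ = γ * P.sampleSize n := by ring

/-- Condition on Y: the labels depend on Y alone, hence are fixed while S is drawn. Measurability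
follows since the event depends on Y only through discrete labels. -/
theorem coinLaw_sample_le (hε : 0 < P.ε) :
    coinLaw P G {c | ¬ SampleGood P G γ (labels P (noisyDegree G c.1.2)) c.1.1} ≤
      ENNReal.ofReal ((P.t n + 1) * (2 + 2 ^ P.t n * 4) *
        (2 * Real.exp (-(γ ^ 2 * Real.log n ^ 2)))) := by
  have i1 := isProbabilityMeasure_noise hε
  have i2 := isProbabilityMeasure_merged_noise h
  have hAm : MeasurableSet {x : Finset (Fin n) × (Fin n → ℝ) |
      ¬ SampleGood P G γ (labels P (noisyDegree G x.2)) x.1} := by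
    have hm : Measurable fun x : Finset (Fin n) × (Fin n → ℝ) =>
        (x.1, labels P (noisyDegree G x.2)) :=
      measurable_fst.prodMk ((measurable_labels G).comp measurable_snd)
    exact hm (MeasurableSet.of_discrete
      (s := {y : Finset (Fin n) × (Fin n → ℤ) | ¬ SampleGood P G γ y.2 y.1}))
  have hmp : MeasurePreserving (fun c : Coins n => c.1) (coinLaw P G)
    ((randomSample (P.sampleSize_le n)).toMeasure.prod
      (Measure.pi fun _ => laplace (6 / P.ε))) := measurePreserving_fst
  refine (hmp.measure_preimage hAm.nullMeasurableSet).trans_le ?_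
  exact prod_le_of_forall_section_symm_le _ _ hAm fun Y =>
    not_sampleGood_le h G (labels P (noisyDegree G Y))

/-- Condition on S and Y. The conjunct `SampleGood` is there to supply |S| = s. -/
theorem coinLaw_neighbors_le (hε : 0 < P.ε)
    (hD : P.clamp n ^ 2 * Real.log n ^ 2 ≤ P.sampleSize n) :
    coinLaw P G {c | SampleGood P G γ (labels P (noisyDegree G c.1.2)) c.1.1 ∧
        ¬ NeighborsGood P G γ (labels P (noisyDegree G c.1.2)) c.1.1 c.2.1.1 c.2.2.1} ≤
      ENNReal.ofReal (P.t n * (2 * Real.exp (-(γ ^ 2 * Real.log n ^ 2))) +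
        2 * Real.exp (-(γ ^ 2 * Real.log n ^ 2))) := by
  have i1 := isProbabilityMeasure_noise hε
  have i2 := isProbabilityMeasure_merged_noise h
  have hAm : MeasurableSet {c : Coins n |
      SampleGood P G γ (labels P (noisyDegree G c.1.2)) c.1.1 ∧
        ¬ NeighborsGood P G γ (labels P (noisyDegree G c.1.2)) c.1.1 c.2.1.1 c.2.2.1} := by
    have hm : Measurable fun c : Coins n =>
        ((c.1.1, labels P (noisyDegree G c.1.2)), (c.2.1.1, c.2.2.1)) :=
      (measurable_fst.fst.prodMk ((measurable_labels G).comp measurable_fst.snd)).prodMk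
        (measurable_snd.fst.fst.prodMk measurable_snd.snd.fst)
    exact hm (MeasurableSet.of_discrete
      (s := {y : (Finset (Fin n) × (Fin n → ℤ)) ×
        ((Fin n → Option (Fin n)) × (Fin n → Option (Fin n))) |
          SampleGood P G γ y.1.2 y.1.1 ∧ ¬ NeighborsGood P G γ y.1.2 y.1.1 y.2.1 y.2.2}))
  refine prod_le_of_forall_section_le _ _ hAm fun x => ?_
  by_cases hx : SampleGood P G γ (labels P (noisyDegree G x.2)) x.1
  · have hm1 := not_neighbors_big_le h G (κ := labels P (noisyDegree G x.2)) hx.card_eq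
    have hm2 := not_neighbors_merged_le h G (κ := labels P (noisyDegree G x.2)) hx.card_eq hD
    have mp1 : MeasurePreserving (fun y : ((Fin n → Option (Fin n)) × (ℤ → ℝ)) ×
        ((Fin n → Option (Fin n)) × ℝ) => y.1.1)
        (((Measure.pi fun v => (randomNeighbor G v).toMeasure).prod
          (Measure.infinitePi fun _ : ℤ => laplace (6 / P.ε))).prod
          ((Measure.pi fun v => (randomNeighbor G v).toMeasure).prod
          (laplace (36 * P.M n * (3 + P.β + 1 / P.β)))))
        (Measure.pi fun v => (randomNeighbor G v).toMeasure) :=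
      measurePreserving_fst.comp measurePreserving_fst
    have mp2 : MeasurePreserving (fun y : ((Fin n → Option (Fin n)) × (ℤ → ℝ)) ×
        ((Fin n → Option (Fin n)) × ℝ) => y.2.1)
        (((Measure.pi fun v => (randomNeighbor G v).toMeasure).prod
          (Measure.infinitePi fun _ : ℤ => laplace (6 / P.ε))).prod
          ((Measure.pi fun v => (randomNeighbor G v).toMeasure).prod
          (laplace (36 * P.M n * (3 + P.β + 1 / P.β)))))
        (Measure.pi fun v => (randomNeighbor G v).toMeasure) :=
      measurePreserving_fst.comp measurePreserving_snd
    rw [← mp1.measure_preimage (MeasurableSet.of_discrete).nullMeasurableSet] at hm1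
    rw [← mp2.measure_preimage (MeasurableSet.of_discrete).nullMeasurableSet] at hm2
    refine (measure_mono ?_).trans (measure_or_le _ _ _ (by positivity) (by positivity) hm1 hm2)
    rintro y ⟨-, hy⟩
    by_contra hcon
    rw [Set.mem_ofPred_eq, not_or] at hcon
    refine hy ⟨fun i hi hi' => ?_, not_lt.mp hcon.2⟩
    by_contra hlt
    exact hcon.1 ⟨i, hi, hi', not_le.mp hlt⟩
  · exact (measure_mono_null (t := ∅) (fun y hy => hx hy.1) measure_empty).le.trans zero_le

theorem not_good_le (hε : 0 < P.ε) (hN : N * P.ε = 24 * Real.log n)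
    (hNlam : N ≤ γ * Real.log n ^ 2) (hD : P.clamp n ^ 2 * Real.log n ^ 2 ≤ P.sampleSize n) :
    coinLaw P G {c | ¬ Good P G γ N c} ≤
      ENNReal.ofReal ((n + P.t n) * (2 * Real.exp (-(2 * Real.log n))) +
        ((P.t n + 1) * (2 + 2 ^ P.t n * 4) + P.t n + 2) *
          (2 * Real.exp (-(γ ^ 2 * Real.log n ^ 2)))) := by
  have hall := measure_or_le (coinLaw P G) _ _ (by positivity) (by positivity)
      (coinLaw_noise_le h G hε hN) <|
    measure_or_le _ _ _ (by positivity) (by positivity) (coinLaw_noise_big_le h G hε hN hNlam) <|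
    measure_or_le _ _ _ (by positivity) (by positivity) (coinLaw_noise_merged_le h G hε hD) <|
    measure_or_le _ _ _ (by positivity) (by positivity) (coinLaw_sample_le h G hε)
      (coinLaw_neighbors_le h G hε hD)
  refine (measure_mono ?_).trans (hall.trans (ENNReal.ofReal_le_ofReal (le_of_eq (by ring))))
  intro c hbad
  by_contra hcon
  simp only [Set.mem_ofPred_eq, not_or, not_exists, not_and, not_not, not_lt] at hcon
  obtain ⟨c1, c2, c3, c4, c5⟩ := hcon
  exact hbad ⟨fun v => c1 v (Finset.mem_univ v), c2, c3, c4, c5 c4⟩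

end Law

/-! ### Asymptotics of the parameters -/

theorem eventually_const_mul_log_pow_le_sqrt (C : ℝ) (k : ℕ) :
    ∀ᶠ n : ℕ in atTop, C * Real.log n ^ k ≤ √(n : ℝ) := by
  have h1 : (fun x : ℝ => C ^ 2 * Real.log x ^ (2 * k)) =o[atTop] (id : ℝ → ℝ) :=
    Real.isLittleO_pow_log_id_atTop.const_mul_left _
  have h2 := tendsto_natCast_atTop_atTop.eventually (h1.bound one_pos)
  filter_upwards [h2] with n hn
  refine Real.le_sqrt_of_sq_le ?_
  rw [mul_pow, ← pow_mul, mul_comm k 2]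
  simp only [one_mul, id, Real.norm_eq_abs, Nat.abs_cast] at hn
  exact (le_abs_self _).trans hn

/-- The product in the definition of `sampleSize`. -/
def sampleBound (P : Params) (n : ℕ) : ℝ :=
  P.t n * (Real.log n ^ 2 / P.ρ ^ 2) * √(n / P.ρ) * (1 + 1 / P.ε)

/-- `n` is large compared with the accuracy parameters and with `1 / ε`. -/
structure Large (P : Params) (n : ℕ) (K A D : ℝ) : Prop where
  ρ_pos : 0 < P.ρ
  ρ_lt : P.ρ < 1 / 4
  β_pos : 0 < P.β
  β_le : P.β ≤ P.ρ / 8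
  ε_pos : 0 < P.ε
  K_eq : K = 2 / Real.log (1 + P.β)
  A_eq : A = 4 * K / (P.ρ ^ 2 * √P.ρ)
  D_eq : D = 12 / P.ρ ^ 2 * (3 + P.β + 1 / P.β)
  one_le_log : 1 ≤ Real.log n
  log_one_add_le : Real.log (1 + P.β) ≤ Real.log n
  inv_ε_le : 1 / P.ε ≤ √√(Real.log n)
  A_log_le : A * Real.log n ^ 4 ≤ √(n : ℝ)
  le_sqrt_sqrt_cube : 24 ≤ P.ρ / 100 * √√(Real.log n) ^ 3
  log_sq_le : 24 * Real.log n ^ 2 ≤ √(n : ℝ)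
  D_log_le : 2 * D * Real.log n ^ 4 ≤ √(n : ℝ)
  D_sq_log_le : D ^ 2 * Real.log n ^ 6 ≤ √(n : ℝ)
  D_A_log_le : (300 / P.ρ * D) ^ 2 * A * Real.log n ^ 8 ≤ √(n : ℝ)
  D_ρ_log_le : 200 / P.ρ * D * Real.log n ^ 2 ≤ √(n : ℝ)
  K_le : 2 * K + 1 ≤ (P.ρ / 100) ^ 2 * Real.log n

namespace Large

variable {P : Params} {n : ℕ} {K A D : ℝ} (h : Large P n K A D)
include h

theorem log_one_add_pos : 0 < Real.log (1 + P.β) := Real.log_pos (by linarith [h.β_pos])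

theorem K_pos : 0 < K := by
  rw [h.K_eq]
  have := h.log_one_add_pos
  positivity

theorem A_pos : 0 < A := by
  rw [h.A_eq]
  have := h.K_pos
  have := h.ρ_pos
  positivity

theorem D_pos : 0 < D := by
  rw [h.D_eq]
  have := h.β_pos
  have := h.ρ_pos
  positivity

theorem n_pos : (0 : ℝ) < n := by
  have h1 := h.one_le_log
  by_contra hn
  have : (n : ℝ) = 0 := le_antisymm (not_lt.mp hn) (Nat.cast_nonneg _)
  rw [this] at h1
  norm_num at h1

theorem one_le_n : (1 : ℝ) ≤ n := by
  have : 0 < n := by exact_mod_cast h.n_pos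
  exact_mod_cast this

theorem one_le_sqrt : 1 ≤ √(n : ℝ) := Real.one_le_sqrt.mpr h.one_le_n

theorem one_le_logb : 1 ≤ Real.logb (1 + P.β) n := by
  rw [Real.logb, one_le_div h.log_one_add_pos]
  exact h.log_one_add_le

theorem one_le_t : (1 : ℝ) ≤ P.t n := h.one_le_logb.trans (Nat.le_ceil _)

/-- The logarithm to base 1 + β is at least 1, so rounding up at most doubles it; this is the 2 in
K. -/
theorem t_le : (P.t n : ℝ) ≤ K * Real.log n := by
  have h1 := Nat.ceil_lt_add_one (a := Real.logb (1 + P.β) n) (by linarith [h.one_le_logb])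
  have h2 : K * Real.log n = 2 * Real.logb (1 + P.β) n := by
    rw [h.K_eq, Real.logb]
    ring
  rw [h2]
  have h3 : (P.t n : ℝ) = (⌈Real.logb (1 + P.β) n⌉₊ : ℝ) := rfl
  linarith [h.one_le_logb]

theorem le_pow_t : (n : ℝ) ≤ (1 + P.β) ^ P.t n := by
  rw [← Real.rpow_natCast, ← Real.logb_le_iff_le_rpow (by linarith [h.β_pos]) h.n_pos]
  exact (Nat.le_ceil _)

theorem one_le_sqrt_sqrt : 1 ≤ √√(Real.log n) :=
  Real.one_le_sqrt.mpr (Real.one_le_sqrt.mpr h.one_le_log)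

theorem sqrt_sqrt_pow : √√(Real.log n) ^ 4 = Real.log n := by
  have : √√(Real.log n) ^ 4 = (√√(Real.log n) ^ 2) ^ 2 := by ring
  rw [this, Real.sq_sqrt (Real.sqrt_nonneg _), Real.sq_sqrt (by linarith [h.one_le_log])]

theorem sqrt_sqrt_le : √√(Real.log n) ≤ Real.log n := by
  conv_rhs => rw [← h.sqrt_sqrt_pow]
  exact le_self_pow₀ h.one_le_sqrt_sqrt (by norm_num)

theorem inv_ε_pos : 0 < 1 / P.ε := one_div_pos.mpr h.ε_pos

theorem sqrt_le_sampleBound : √(n : ℝ) ≤ sampleBound P n := by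
  have hρ := h.ρ_pos
  have hρ1 := h.ρ_lt
  have h1 : 1 ≤ Real.log n ^ 2 / P.ρ ^ 2 := by
    rw [one_le_div (by positivity)]
    have := h.one_le_log
    gcongr
    linarith
  have h2 : √(n : ℝ) ≤ √(n / P.ρ) := by
    refine Real.sqrt_le_sqrt ?_
    rw [le_div_iff₀ hρ]
    nlinarith [h.n_pos]
  have h3 : 1 ≤ 1 + 1 / P.ε := by linarith [h.inv_ε_pos]
  have h4 := h.one_le_t
  calc √(n : ℝ) = 1 * 1 * √(n : ℝ) * 1 := by ring
    _ ≤ sampleBound P n := by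
      unfold sampleBound
      gcongr

theorem two_mul_sampleBound_le : 2 * sampleBound P n ≤ A * Real.log n ^ 4 * √(n : ℝ) := by
  have hρ := h.ρ_pos
  have hε := h.inv_ε_pos
  have hK := h.K_pos
  have h0 := h.one_le_log
  have h1 : 1 + 1 / P.ε ≤ 2 * Real.log n := by
    linarith [h.inv_ε_le, h.sqrt_sqrt_le]
  have h2 := h.t_le
  calc 2 * sampleBound P n
      = 2 * (P.t n * (Real.log n ^ 2 / P.ρ ^ 2) * √(n / P.ρ) * (1 + 1 / P.ε)) := rfl
    _ ≤ 2 * (K * Real.log n * (Real.log n ^ 2 / P.ρ ^ 2) * √(n / P.ρ) * (2 * Real.log n)) := by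
      gcongr
    _ = _ := by
      rw [h.A_eq, Real.sqrt_div h.n_pos.le]
      field_simp
      ring

theorem sampleSize_eq : P.sampleSize n = ⌈sampleBound P n⌉₊ := by
  rw [Params.sampleSize]
  refine min_eq_right (Nat.ceil_le.mpr ?_)
  change sampleBound P n ≤ n
  have h1 := h.two_mul_sampleBound_le
  have h2 := mul_le_mul_of_nonneg_right h.A_log_le (Real.sqrt_nonneg (n : ℝ))
  rw [Real.mul_self_sqrt h.n_pos.le] at h2
  linarith [h.sqrt_le_sampleBound, h.one_le_sqrt]

theorem sampleBound_le_sampleSize : sampleBound P n ≤ P.sampleSize n := by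
  rw [h.sampleSize_eq]
  exact Nat.le_ceil _

theorem sampleSize_le_two_mul : (P.sampleSize n : ℝ) ≤ 2 * sampleBound P n := by
  rw [h.sampleSize_eq]
  have h1 := h.sqrt_le_sampleBound
  have h2 := h.one_le_sqrt
  have := Nat.ceil_lt_add_one (a := sampleBound P n) (by linarith)
  linarith

theorem sqrt_le_sampleSize : √(n : ℝ) ≤ P.sampleSize n :=
  h.sqrt_le_sampleBound.trans h.sampleBound_le_sampleSize

theorem T_nonneg : 0 ≤ P.T n := by
  have := h.ε_pos
  rw [Params.T]
  positivity

theorem t_mul_T_le : P.t n * P.T n ≤ 1 / 2 * √(P.ρ / n) := by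
  have hε := h.ε_pos
  have ht := h.one_le_t
  have h1 : P.t n * P.T n = 1 / 2 * √(P.ρ / n) * (P.ε / (1 + P.ε)) := by
    rw [Params.T]
    field_simp
  rw [h1]
  refine mul_le_of_le_one_right (by positivity) ?_
  rw [div_le_one (by positivity)]
  linarith

/-- The factors of T are inverse to those of the sample size, so a bucket at the threshold contains
order log² n sampled vertices, as concentration requires. -/
theorem T_mul_sampleBound : P.T n * sampleBound P n = 1 / 2 * (Real.log n ^ 2 / P.ρ ^ 2) := by
  have hε := h.ε_pos
  have ht := h.one_le_t
  have hρ := h.ρ_pos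
  have hn := h.n_pos
  have h1 : √(P.ρ / n) * √(n / P.ρ) = 1 := by
    rw [← Real.sqrt_mul (by positivity), div_mul_div_cancel₀ hn.ne', div_self hρ.ne',
      Real.sqrt_one]
  have h2 : P.ε / (1 + P.ε) * (1 + 1 / P.ε) = 1 := by field_simp; ring
  have h3 : 1 / (P.t n : ℝ) * P.t n = 1 := by field_simp
  rw [Params.T, sampleBound]
  calc 1 / 2 * √(P.ρ / n) * (P.ε / (1 + P.ε)) * (1 / P.t n) *
        (P.t n * (Real.log n ^ 2 / P.ρ ^ 2) * √(n / P.ρ) * (1 + 1 / P.ε))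
      = 1 / 2 * (√(P.ρ / n) * √(n / P.ρ)) * (P.ε / (1 + P.ε) * (1 + 1 / P.ε)) *
          (1 / P.t n * P.t n) * (Real.log n ^ 2 / P.ρ ^ 2) := by ring
    _ = _ := by rw [h1, h2, h3]; ring

theorem inv_ρ_sq_ge : 16 * Real.log n ^ 2 ≤ Real.log n ^ 2 / P.ρ ^ 2 := by
  have hρ := h.ρ_pos
  have hρ1 := h.ρ_lt
  rw [le_div_iff₀ (by positivity)]
  have h1 : P.ρ ^ 2 ≤ (1 / 4) ^ 2 := by gcongr
  nlinarith [sq_nonneg (Real.log n)]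

/-- `M` with the sample size replaced by `sampleBound`. -/
theorem M_sampleBound :
    1 / 3 * √(P.ρ / (n * √(Real.log n))) * (sampleBound P n / P.t n) =
      1 / 3 * (√√(Real.log n) ^ 7 / P.ρ ^ 2) * (1 + 1 / P.ε) := by
  have ht := h.one_le_t
  have hρ := h.ρ_pos
  have hn := h.n_pos
  have hq := h.one_le_sqrt_sqrt
  have h1 : √(P.ρ / (n * √(Real.log n))) * √(n / P.ρ) = 1 / √√(Real.log n) := by
    have hl : 0 < √(Real.log n) := Real.sqrt_pos.mpr (by linarith [h.one_le_log])
    rw [← Real.sqrt_mul (by positivity), ← Real.sqrt_one, ← Real.sqrt_div zero_le_one]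
    congr 1
    field_simp
  have h2 : sampleBound P n / P.t n = Real.log n ^ 2 / P.ρ ^ 2 * √(n / P.ρ) * (1 + 1 / P.ε) := by
    rw [sampleBound]
    field_simp
  have h3 : Real.log n ^ 2 = √√(Real.log n) ^ 8 := by
    conv_lhs => rw [← h.sqrt_sqrt_pow]
    ring
  rw [h2, h3]
  calc 1 / 3 * √(P.ρ / (n * √(Real.log n))) *
        (√√(Real.log n) ^ 8 / P.ρ ^ 2 * √(n / P.ρ) * (1 + 1 / P.ε))
      = 1 / 3 * (√(P.ρ / (n * √(Real.log n))) * √(n / P.ρ)) *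
          (√√(Real.log n) ^ 8 / P.ρ ^ 2) * (1 + 1 / P.ε) := by ring
    _ = _ := by
      rw [h1]
      field_simp

/-- Apart from rounding, M is log^{7/4} n · (1 + 1/ε)/(3ρ²), and 1/(3ρ²) ≥ 1 since ρ < 1/4. -/
theorem le_M : √√(Real.log n) ^ 7 * (1 + 1 / P.ε) ≤ P.M n := by
  have hρ := h.ρ_pos
  have hρ1 := h.ρ_lt
  have hε := h.inv_ε_pos
  have ht := h.one_le_t
  have h1 : 1 / 3 * (√√(Real.log n) ^ 7 / P.ρ ^ 2) * (1 + 1 / P.ε) ≤ P.M n := by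
    rw [← h.M_sampleBound, Params.M]
    have := h.sampleBound_le_sampleSize
    gcongr
  refine le_trans ?_ h1
  gcongr
  have h2 : P.ρ ^ 2 ≤ (1 / 4) ^ 2 := by gcongr
  have h3 : 0 ≤ √√(Real.log n) ^ 7 := by positivity
  rw [one_div_mul_eq_div, div_div, le_div_iff₀ (by positivity)]
  nlinarith

theorem M_le : P.M n ≤ 2 * Real.log n ^ 2 / P.ρ ^ 2 := by
  have hρ := h.ρ_pos
  have hε := h.inv_ε_pos
  have ht := h.one_le_t
  have hq := h.one_le_sqrt_sqrt
  have h1 : P.M n ≤ 2 * (1 / 3 * (√√(Real.log n) ^ 7 / P.ρ ^ 2) * (1 + 1 / P.ε)) := by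
    have := h.sampleSize_le_two_mul
    rw [← h.M_sampleBound]
    calc P.M n ≤ 1 / 3 * √(P.ρ / (n * √(Real.log n))) * (2 * sampleBound P n / P.t n) := by
          rw [Params.M]
          gcongr
      _ = _ := by ring
  have h2 : 1 + 1 / P.ε ≤ 2 * √√(Real.log n) := by linarith [h.inv_ε_le]
  have h3 : Real.log n ^ 2 = √√(Real.log n) ^ 8 := by
    conv_lhs => rw [← h.sqrt_sqrt_pow]
    ring
  refine h1.trans ?_
  calc 2 * (1 / 3 * (√√(Real.log n) ^ 7 / P.ρ ^ 2) * (1 + 1 / P.ε))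
      ≤ 2 * (1 / 3 * (√√(Real.log n) ^ 7 / P.ρ ^ 2) * (2 * √√(Real.log n))) := by gcongr
    _ = 4 / 3 * (√√(Real.log n) ^ 8 / P.ρ ^ 2) := by ring
    _ ≤ 2 * (√√(Real.log n) ^ 8 / P.ρ ^ 2) := by gcongr; norm_num
    _ = _ := by rw [h3]; ring

theorem clamp_le : P.clamp n ≤ D * Real.log n ^ 2 := by
  have hβ := h.β_pos
  have h1 := h.M_le
  calc P.clamp n = 6 * P.M n * (3 + P.β + 1 / P.β) := rfl
    _ ≤ 6 * (2 * Real.log n ^ 2 / P.ρ ^ 2) * (3 + P.β + 1 / P.β) := by gcongr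
    _ = _ := by rw [h.D_eq]; ring

theorem one_le_M : 1 ≤ P.M n := by
  have h1 : 1 ≤ √√(Real.log n) ^ 7 := one_le_pow₀ h.one_le_sqrt_sqrt
  have h2 := h.inv_ε_pos
  refine le_trans ?_ h.le_M
  nlinarith

theorem clamp_nonneg : 0 ≤ P.clamp n := by
  have := h.β_pos
  have := h.one_le_M
  rw [Params.clamp]
  positivity

theorem noise_le_lam : 24 * Real.log n / P.ε ≤ P.ρ / 100 * Real.log n ^ 2 := by
  have h0 := h.one_le_log
  have hq := h.one_le_sqrt_sqrt
  calc 24 * Real.log n / P.ε = 24 * Real.log n * (1 / P.ε) := by ring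
    _ ≤ (P.ρ / 100 * √√(Real.log n) ^ 3) * Real.log n * √√(Real.log n) := by
      have := h.le_sqrt_sqrt_cube
      have := h.inv_ε_le
      have := h.inv_ε_pos
      have := h.ρ_pos
      gcongr
    _ = P.ρ / 100 * Real.log n * √√(Real.log n) ^ 4 := by ring
    _ = _ := by rw [h.sqrt_sqrt_pow]; ring

theorem regime : Regime P n (P.ρ / 100) (24 * Real.log n / P.ε) where
  n_pos := by exact_mod_cast h.n_pos
  β_pos := h.β_pos
  ρ_pos := h.ρ_pos
  ρ_lt := h.ρ_lt
  β_le := h.β_le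
  γ_eq := rfl
  s_pos := by
    have : (0 : ℝ) < P.sampleSize n := by linarith [h.sqrt_le_sampleSize, h.one_le_sqrt]
    exact_mod_cast this
  one_le_lam := one_le_pow₀ h.one_le_log
  lam_le := by
    have h1 := mul_le_mul_of_nonneg_left h.sampleBound_le_sampleSize h.T_nonneg
    rw [h.T_mul_sampleBound] at h1
    linarith [h.inv_ρ_sq_ge, sq_nonneg (Real.log n)]
  one_le_M := h.one_le_M
  N_le_M := by
    have hρ := h.ρ_pos
    have hε := h.inv_ε_pos
    have hq := h.one_le_sqrt_sqrt
    calc 24 * Real.log n / P.ε = 24 * Real.log n * (1 / P.ε) := by ring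
      -- M carries the factor 1 + 1/ε, which absorbs the 1/ε of the noise; the surplus log^{3/4} n
      -- of M pays for 24/γ.
      _ ≤ (P.ρ / 100 * √√(Real.log n) ^ 3) * Real.log n * (1 + 1 / P.ε) := by
        have := h.le_sqrt_sqrt_cube
        have := h.one_le_log
        gcongr
        linarith
      _ = P.ρ / 100 * (√√(Real.log n) ^ 3 * √√(Real.log n) ^ 4 * (1 + 1 / P.ε)) := by
        rw [h.sqrt_sqrt_pow]; ring
      _ = P.ρ / 100 * (√√(Real.log n) ^ 7 * (1 + 1 / P.ε)) := by ring
      _ ≤ P.ρ / 100 * P.M n := by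
        gcongr
        exact h.le_M
  N_le_n := by
    refine h.noise_le_lam.trans ?_
    have h1 : √(n : ℝ) ≤ n := by
      rw [Real.sqrt_le_left h.n_pos.le]
      nlinarith [h.one_le_n]
    have h2 := h.log_sq_le
    have h3 := h.ρ_lt
    nlinarith [sq_nonneg (Real.log n)]
  T_le := h.t_mul_T_le
  n_le := h.le_pow_t
  clamp_lam_le := by
    refine le_trans ?_ (h.D_log_le.trans h.sqrt_le_sampleSize)
    have := mul_le_mul_of_nonneg_right h.clamp_le (sq_nonneg (Real.log n))
    linarith
  -- T ≤ n^{-1/2} and √s is n^{1/4} up to logarithms, so the product is n^{-1/4} up to logarithms.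
  T_sqrt_le := by
    have hρ := h.ρ_pos
    have hρ1 := h.ρ_lt
    have hn := h.n_pos
    have hD := h.D_pos
    have hA := h.A_pos
    have hl := h.one_le_log
    have hsn : 0 < √(n : ℝ) := Real.sqrt_pos.mpr hn
    have hT : P.T n ≤ 1 / √(n : ℝ) := by
      have h1 : P.T n ≤ P.t n * P.T n := le_mul_of_one_le_left h.T_nonneg h.one_le_t
      refine h1.trans (h.t_mul_T_le.trans ?_)
      rw [Real.sqrt_div hρ.le, mul_div_assoc']
      gcongr
      have : √P.ρ ≤ 1 := Real.sqrt_le_one.mpr (by linarith)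
      linarith
    have hs : √(P.sampleSize n : ℝ) ≤ √(A * Real.log n ^ 4 * √(n : ℝ)) :=
      Real.sqrt_le_sqrt (h.sampleSize_le_two_mul.trans h.two_mul_sampleBound_le)
    have hfin : 300 / P.ρ * D * Real.log n ^ 2 * √(A * Real.log n ^ 4 * √(n : ℝ)) ≤ √(n : ℝ) := by
      refine Real.le_sqrt_of_sq_le ?_
      rw [mul_pow, Real.sq_sqrt (by positivity)]
      calc (300 / P.ρ * D * Real.log n ^ 2) ^ 2 * (A * Real.log n ^ 4 * √(n : ℝ))
          = (300 / P.ρ * D) ^ 2 * A * Real.log n ^ 8 * √(n : ℝ) := by ring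
        _ ≤ √(n : ℝ) * √(n : ℝ) := by
          gcongr
          exact h.D_A_log_le
        _ = n := Real.mul_self_sqrt hn.le
    calc 3 * P.T n * √(P.sampleSize n : ℝ) * P.clamp n
        ≤ 3 * (1 / √(n : ℝ)) * √(A * Real.log n ^ 4 * √(n : ℝ)) * (D * Real.log n ^ 2) := by
          have := h.clamp_le
          have := h.clamp_nonneg
          gcongr
      _ = P.ρ / 100 * (1 / √(n : ℝ)) *
          (300 / P.ρ * D * Real.log n ^ 2 * √(A * Real.log n ^ 4 * √(n : ℝ))) := by
          field_simp
          ring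
      _ ≤ P.ρ / 100 * (1 / √(n : ℝ)) * √(n : ℝ) := by gcongr
      _ = P.ρ / 100 := by field_simp
  sqrt_clamp_le := by
    have hρ := h.ρ_pos
    have hn := h.n_pos
    have h1 := h.D_ρ_log_le
    calc 2 * √(n : ℝ) * P.clamp n ≤ 2 * √(n : ℝ) * (D * Real.log n ^ 2) := by
          have := h.clamp_le
          gcongr
      _ = P.ρ / 100 * √(n : ℝ) * (200 / P.ρ * D * Real.log n ^ 2) := by
          field_simp
          ring
      _ ≤ P.ρ / 100 * √(n : ℝ) * √(n : ℝ) := by gcongr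
      _ = P.ρ / 100 * n := by rw [mul_assoc, Real.mul_self_sqrt hn.le]

theorem clamp_sq_lam_le : P.clamp n ^ 2 * Real.log n ^ 2 ≤ P.sampleSize n := by
  have h0 := h.clamp_nonneg
  have h1 := h.clamp_le
  calc P.clamp n ^ 2 * Real.log n ^ 2 ≤ (D * Real.log n ^ 2) ^ 2 * Real.log n ^ 2 := by gcongr
    _ = D ^ 2 * Real.log n ^ 6 := by ring
    _ ≤ _ := h.D_sq_log_le.trans h.sqrt_le_sampleSize

/-- The number of union-bound terms is at most 8 · 4^t ≤ 8 n^{2K}, and `K_le` makes exp(-γ² log² n)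
at most n^{-(2K+1)}. -/
theorem failure_le :
    ((n : ℝ) + P.t n) * (2 * Real.exp (-(2 * Real.log n))) +
        ((P.t n + 1) * (2 + 2 ^ P.t n * 4) + P.t n + 2) *
          (2 * Real.exp (-((P.ρ / 100) ^ 2 * Real.log n ^ 2))) ≤ 20 / n := by
  have hn := h.n_pos
  have hl := h.one_le_log
  have htn : (P.t n : ℝ) ≤ n := by
    have h1 : (P.t n : ℝ) ≤ P.sampleSize n := by
      refine le_trans ?_ h.sampleBound_le_sampleSize
      have hρ := h.ρ_pos
      have e1 : 1 ≤ Real.log n ^ 2 / P.ρ ^ 2 := by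
        linarith [h.inv_ρ_sq_ge, one_le_pow₀ hl (n := 2)]
      have e2 : 1 ≤ √(n / P.ρ) := by
        rw [Real.one_le_sqrt, one_le_div hρ]
        linarith [h.one_le_n, h.ρ_lt]
      have e3 : 1 ≤ 1 + 1 / P.ε := by linarith [h.inv_ε_pos]
      calc (P.t n : ℝ) = P.t n * 1 * 1 * 1 := by ring
        _ ≤ sampleBound P n := by unfold sampleBound; gcongr
    exact h1.trans (by exact_mod_cast P.sampleSize_le n)
  have he1 : Real.exp (-Real.log n) = 1 / n := by
    rw [Real.exp_neg, Real.exp_log hn, one_div]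
  have he2 : Real.exp (-(2 * Real.log n)) = 1 / n * (1 / n) := by
    rw [← he1, ← Real.exp_add]
    ring_nf
  have hA : ((n : ℝ) + P.t n) * (2 * Real.exp (-(2 * Real.log n))) ≤ 4 / n := by
    rw [he2]
    calc ((n : ℝ) + P.t n) * (2 * (1 / n * (1 / n))) ≤ (n + n) * (2 * (1 / n * (1 / n))) := by
          gcongr
      _ = 4 / n := by field_simp; ring
  have ht2 : (P.t n : ℝ) + 1 ≤ 2 ^ P.t n := by
    have : P.t n + 1 ≤ 2 ^ P.t n := Nat.lt_two_pow_self
    exact_mod_cast this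
  have hB : ((P.t n : ℝ) + 1) * (2 + 2 ^ P.t n * 4) + P.t n + 2 ≤ 8 * (2 ^ P.t n * 2 ^ P.t n) := by
    have := h.one_le_t
    nlinarith
  have h2e : (2 : ℝ) ^ P.t n ≤ Real.exp (K * Real.log n) := by
    calc (2 : ℝ) ^ P.t n ≤ Real.exp 1 ^ P.t n := by
          gcongr
          linarith [Real.add_one_le_exp 1]
      _ = Real.exp (P.t n) := by rw [← Real.exp_nat_mul, mul_one]
      _ ≤ _ := Real.exp_le_exp.mpr h.t_le
  have hC : (((P.t n : ℝ) + 1) * (2 + 2 ^ P.t n * 4) + P.t n + 2) *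
      (2 * Real.exp (-((P.ρ / 100) ^ 2 * Real.log n ^ 2))) ≤ 16 / n := by
    calc (((P.t n : ℝ) + 1) * (2 + 2 ^ P.t n * 4) + P.t n + 2) *
          (2 * Real.exp (-((P.ρ / 100) ^ 2 * Real.log n ^ 2)))
        ≤ 8 * (Real.exp (K * Real.log n) * Real.exp (K * Real.log n)) *
          (2 * Real.exp (-((P.ρ / 100) ^ 2 * Real.log n ^ 2))) := by
          refine mul_le_mul_of_nonneg_right (hB.trans ?_) (by positivity)
          gcongr
      _ = 16 * Real.exp (K * Real.log n + K * Real.log n +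
            -((P.ρ / 100) ^ 2 * Real.log n ^ 2)) := by
          rw [Real.exp_add, Real.exp_add]; ring
      _ ≤ 16 * Real.exp (-Real.log n) := by
          gcongr
          have := mul_le_mul_of_nonneg_right h.K_le (by linarith : 0 ≤ Real.log n)
          linarith
      _ = 16 / n := by rw [he1]; ring
  calc _ ≤ 4 / (n : ℝ) + 16 / n := add_le_add hA hC
    _ = 20 / n := by ring

end Large

theorem eventually_large {ρ β : ℝ} {ε : ℕ → ℝ} (hρ : 0 < ρ) (hρ' : ρ < 1 / 4) (hβ : 0 < β)
    (hβ' : β ≤ ρ / 8) (hε : ∀ n, 0 < ε n)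
    (hε' : (fun n => (ε n)⁻¹) =o[atTop] fun n : ℕ => Real.log n ^ (1 / 4 : ℝ)) :
    ∀ᶠ n : ℕ in atTop, Large ⟨ρ, β, ε n⟩ n (2 / Real.log (1 + β))
      (4 * (2 / Real.log (1 + β)) / (ρ ^ 2 * √ρ)) (12 / ρ ^ 2 * (3 + β + 1 / β)) := by
  have hlog : Tendsto (fun n : ℕ => Real.log n) atTop atTop :=
    Real.tendsto_log_atTop.comp tendsto_natCast_atTop_atTop
  have hq : Tendsto (fun n : ℕ => ρ / 100 * √√(Real.log n) ^ 3) atTop atTop :=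
    ((tendsto_pow_atTop (by norm_num)).comp
      (Real.tendsto_sqrt_atTop.comp (Real.tendsto_sqrt_atTop.comp hlog))).const_mul_atTop
        (by positivity)
  have hl2 : Tendsto (fun n : ℕ => (ρ / 100) ^ 2 * Real.log n) atTop atTop :=
    hlog.const_mul_atTop (by positivity)
  set K := 2 / Real.log (1 + β) with hK
  set A := 4 * K / (ρ ^ 2 * √ρ) with hA
  set D := 12 / ρ ^ 2 * (3 + β + 1 / β) with hD
  filter_upwards [hlog.eventually_ge_atTop 1, hlog.eventually_ge_atTop (Real.log (1 + β)),
    hε'.bound one_pos, hq.eventually_ge_atTop 24, hl2.eventually_ge_atTop (2 * K + 1),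
    eventually_const_mul_log_pow_le_sqrt A 4, eventually_const_mul_log_pow_le_sqrt 24 2,
    eventually_const_mul_log_pow_le_sqrt (2 * D) 4, eventually_const_mul_log_pow_le_sqrt (D ^ 2) 6,
    eventually_const_mul_log_pow_le_sqrt ((300 / ρ * D) ^ 2 * A) 8,
    eventually_const_mul_log_pow_le_sqrt (200 / ρ * D) 2]
    with n h1 h2 h3 h4 h5 h6 h7 h8 h9 h10 h11
  refine ⟨hρ, hρ', hβ, hβ', hε n, rfl, rfl, rfl, h1, h2, ?_, h6, h4, h7, h8, h9, h10, h11, h5⟩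
  have h12 : √√(Real.log n) = Real.log n ^ (1 / 4 : ℝ) := by
    rw [Real.sqrt_eq_rpow, Real.sqrt_eq_rpow, ← Real.rpow_mul (by linarith)]
    norm_num
  rw [h12, one_div]
  rw [one_mul, Real.norm_of_nonneg (inv_nonneg.mpr (hε n).le),
    Real.norm_of_nonneg (Real.rpow_nonneg (by linarith) _)] at h3
  exact h3

end DPAvgDegree

end

theorem theorem6 (ρ β : ℝ) (ε : ℕ → ℝ) (hρ : 0 < ρ) (hρ' : ρ < 1 / 4) (hβ : 0 < β)
    (hβ' : β ≤ ρ / 8) (hε : ∀ n, 0 < ε n)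
    (hε' : (fun n => (ε n)⁻¹) =o[atTop] fun n : ℕ => Real.log n ^ (1 / 4 : ℝ)) :
    ∃ δ : ℕ → ℝ, Tendsto δ atTop (𝓝 0) ∧
      ∀ᶠ n : ℕ in atTop, ∀ G : SimpleGraph (Fin n), 1 ≤ DPAvgDegree.avgDegree G →
        1 - δ n ≤ (DPAvgDegree.coinLaw ⟨ρ, β, ε n⟩ G).real
          {c | (1 - ρ) * DPAvgDegree.avgDegree G ≤ DPAvgDegree.mainAlgorithm ⟨ρ, β, ε n⟩ G c ∧
            DPAvgDegree.mainAlgorithm ⟨ρ, β, ε n⟩ G c ≤ (1 + ρ) * DPAvgDegree.avgDegree G} := by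
  refine ⟨fun n => 20 / n, tendsto_const_div_atTop_nhds_zero_nat 20, ?_⟩
  filter_upwards [DPAvgDegree.eventually_large hρ hρ' hβ hβ' hε hε'] with n hL G hG
  have hR := hL.regime
  have hprob := DPAvgDegree.isProbabilityMeasure_coinLaw hR G (hε n)
  have hbad := DPAvgDegree.not_good_le hR G (hε n) (div_mul_cancel₀ _ (hε n).ne') hL.noise_le_lam
    hL.clamp_sq_lam_le
  set μ := DPAvgDegree.coinLaw ⟨ρ, β, ε n⟩ G
  set E := {c | (1 - ρ) * DPAvgDegree.avgDegree G ≤ DPAvgDegree.mainAlgorithm ⟨ρ, β, ε n⟩ G c ∧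
    DPAvgDegree.mainAlgorithm ⟨ρ, β, ε n⟩ G c ≤ (1 + ρ) * DPAvgDegree.avgDegree G}
  have hsub : Eᶜ ⊆ {c | ¬ DPAvgDegree.Good ⟨ρ, β, ε n⟩ G (ρ / 100)
      (24 * Real.log n / ε n) c} := fun c hc hgood =>
    hc (DPAvgDegree.mainAlgorithm_bounds hR hgood hG)
  have hbad' : μ.real Eᶜ ≤ 20 / n := by
    refine ENNReal.toReal_le_of_le_ofReal (by positivity) ?_
    exact (measure_mono hsub).trans (hbad.trans (ENNReal.ofReal_le_ofReal hL.failure_le))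
  -- Subadditivity suffices, so measurability of the success event is not needed.
  have htot : 1 ≤ μ.real E + μ.real Eᶜ := by
    have h1 := measureReal_union_le (μ := μ) E Eᶜ
    rwa [Set.union_compl_self, probReal_univ] at h1
  linarith
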